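/- Let $(\overline M,J,\overline g)$ be a locally conformal Kähler manifold: a smooth almost Hermitian manifold in which every point has an open neighbourhood $U$ with a smooth function $f_U$ on $U$ such that $e^{-f_U}\,\overline g|_U$ is Kähler, i.e. Hermitian with $J$ parallel for its Levi-Civita connection. Let $\Omega(X,Y)=\overline g(X,JY)$ be the Kähler form, $\omega$ the Lee form, i.e. a closed $1$-form with $d\Omega=\omega\wedge\Omega$, and $B=\omega^\sharp$ the Lee vector field, $\overline g(X,B)=\omega(X)$. Let $M$ be an (immersed) CR-submanifold of $\overline M$ with induced metric $g$: there is a smooth distribution $D$ on $M$ with $JD_p=D_p$ for all $p\in M$, whose orthogonal complement $D^\perp$ in $TM$ satisfies $JD_p^\perp\subset T_p^\perp M$. Let $h$ be the second fundamental form of $M$ in $\overline M$, and let $\mu$ be the orthogonal complement of $JD^\perp$ in the normal bundle $TM^\perp$. Assume that $B$ is normal to $M$ at every point of $M$. Then $D^\perp$ is integrable, so that it is tangent to a foliation $\mathfrak F^\perp$ of $M$ (the totally real foliation), and: (i) If $M$ is mixed geodesic, i.e. $h(X,Y)=0$ for all $X\in\Gamma(D)$, $Y\in\Gamma(D^\perp)$,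 then $\mathfrak F^\perp$ is totally geodesic, i.e. every leaf of $\mathfrak F^\perp$ is a totally geodesic submanifold of $(M,g)$. (ii) If $M$ is anti-holomorphic (generic), i.e. $\mu=0$, then $M$ is mixed geodesic if and only if $\mathfrak F^\perp$ is totally geodesic. -/

import Mathlib

open Bundle
open scoped Manifold ContDiff

universe u

namespace CRGeometry

noncomputable section

/-! All manifolds are smooth, without boundary, and modelled on finite-dimensional real normed
spaces. A covariant 2-tensor field is a family `x ↦ g x` of bilinear forms on the tangent spaces. -/

section Tensors

variable {E : Type*} [NormedAddCommGroup E] [NormedSpace ℝ E]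
  {N : Type*} [TopologicalSpace N] [ChartedSpace E N]

/-- Raising an index: the (unique, when `g` is a Riemannian metric and `α` is linear) tangent vector
`u` at `q` with `g(u, w) = α(w)` for all `w`. -/
def sharp (g : Π x : N, TangentSpace 𝓘(ℝ, E) x →L[ℝ] TangentSpace 𝓘(ℝ, E) x →L[ℝ] ℝ)
    (q : N) (α : TangentSpace 𝓘(ℝ, E) q → ℝ) : TangentSpace 𝓘(ℝ, E) q :=
  Classical.epsilon fun u => ∀ w, g q u w = α w

/-- `sharp` does what it should for a positive definite form. -/
theorem sharp_spec [FiniteDimensional ℝ E]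
    (g : Π x : N, TangentSpace 𝓘(ℝ, E) x →L[ℝ] TangentSpace 𝓘(ℝ, E) x →L[ℝ] ℝ) (q : N)
    (hpos : ∀ v : TangentSpace 𝓘(ℝ, E) q, v ≠ 0 → 0 < g q v v)
    (α : TangentSpace 𝓘(ℝ, E) q →ₗ[ℝ] ℝ) (w : TangentSpace 𝓘(ℝ, E) q) :
    g q (sharp g q α) w = α w := by
  have : FiniteDimensional ℝ (TangentSpace 𝓘(ℝ, E) q) := inferInstanceAs (FiniteDimensional ℝ E)
  let B : TangentSpace 𝓘(ℝ, E) q →ₗ[ℝ] Module.Dual ℝ (TangentSpace 𝓘(ℝ, E) q) :=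
    { toFun := fun u => (g q u).toLinearMap
      map_add' := fun a b => by ext; simp
      map_smul' := fun c a => by ext; simp }
  have hinj : Function.Injective B := by
    rw [← LinearMap.ker_eq_bot, LinearMap.ker_eq_bot']
    intro v hv
    by_contra hne
    have h0 : g q v v = 0 := by
      have := congrArg (fun l => l v) hv
      simpa [B] using this
    exact absurd h0 (hpos v hne).ne'
  have hsurj : Function.Surjective B :=
    (LinearMap.injective_iff_surjective_of_finrank_eq_finrank
      (Subspace.dual_finrank_eq (K := ℝ) (V := TangentSpace 𝓘(ℝ, E) q)).symm).1 hinj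
  obtain ⟨u, hu⟩ := hsurj α
  have hex : ∃ u, ∀ w, g q u w = α w :=
    ⟨u, fun w => by simpa [B] using congrArg (fun l => l w) hu⟩
  exact Classical.epsilon_spec hex w

variable [IsManifold 𝓘(ℝ, E) ∞ N]

/-- `∂_a T(b, c)` at `q`: the derivative in the direction `a` of the component `T(b, c)`
of the tensor field `T`, in the coordinates given by the chart at `q`. Here `FiberBundle.extend E b`
is the local vector field with constant components `b` in that chart. -/
def partialDeriv₂ (T : Π x : N, TangentSpace 𝓘(ℝ, E) x →L[ℝ] TangentSpace 𝓘(ℝ, E) x →L[ℝ] ℝ)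
    (q : N) (a b c : TangentSpace 𝓘(ℝ, E) q) : ℝ :=
  mvfderiv 𝓘(ℝ, E) (fun x => T x (FiberBundle.extend E b x) (FiberBundle.extend E c x)) q a

/-- `∂_a η(b)` at `q`, in the coordinates given by the chart at `q`. -/
def partialDeriv₁ (η : Π x : N, TangentSpace 𝓘(ℝ, E) x →L[ℝ] ℝ)
    (q : N) (a b : TangentSpace 𝓘(ℝ, E) q) : ℝ :=
  mvfderiv 𝓘(ℝ, E) (fun x => η x (FiberBundle.extend E b x)) q a

/-- The exterior derivative `dη(a, b) = ∂_a η(b) - ∂_b η(a)` of a 1-form. -/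
def extDeriv₁ (η : Π x : N, TangentSpace 𝓘(ℝ, E) x →L[ℝ] ℝ)
    (q : N) (a b : TangentSpace 𝓘(ℝ, E) q) : ℝ :=
  partialDeriv₁ η q a b - partialDeriv₁ η q b a

/-- The exterior derivative `dΩ(a, b, c) = ∂_a Ω(b, c) - ∂_b Ω(a, c) + ∂_c Ω(a, b)` of a 2-form. -/
def extDeriv₂ (Ω : Π x : N, TangentSpace 𝓘(ℝ, E) x →L[ℝ] TangentSpace 𝓘(ℝ, E) x →L[ℝ] ℝ)
    (q : N) (a b c : TangentSpace 𝓘(ℝ, E) q) : ℝ :=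
  partialDeriv₂ Ω q a b c - partialDeriv₂ Ω q b a c + partialDeriv₂ Ω q c a b

/-- The wedge product `(η ∧ Ω)(a, b, c)` of a 1-form and a 2-form. -/
def wedge₁₂ (η : Π x : N, TangentSpace 𝓘(ℝ, E) x →L[ℝ] ℝ)
    (Ω : Π x : N, TangentSpace 𝓘(ℝ, E) x →L[ℝ] TangentSpace 𝓘(ℝ, E) x →L[ℝ] ℝ)
    (q : N) (a b c : TangentSpace 𝓘(ℝ, E) q) : ℝ :=
  η q a * Ω q b c - η q b * Ω q a c + η q c * Ω q a b

/-- The Christoffel symbol `Γ(a, b)` of the metric `g` at `q`, in the coordinates given by the chart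
at `q`: `g(Γ(a, b), c) = ½ (∂_a g(b, c) + ∂_b g(a, c) - ∂_c g(a, b))`. -/
def christoffel (g : Π x : N, TangentSpace 𝓘(ℝ, E) x →L[ℝ] TangentSpace 𝓘(ℝ, E) x →L[ℝ] ℝ)
    (q : N) (a b : TangentSpace 𝓘(ℝ, E) q) : TangentSpace 𝓘(ℝ, E) q :=
  sharp g q fun c =>
    (partialDeriv₂ g q a b c + partialDeriv₂ g q b a c - partialDeriv₂ g q c a b) / 2

end Tensors

section Maps

variable {E : Type*} [NormedAddCommGroup E] [NormedSpace ℝ E]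
  {N : Type*} [TopologicalSpace N] [ChartedSpace E N] [IsManifold 𝓘(ℝ, E) ∞ N]
  {E' : Type*} [NormedAddCommGroup E'] [NormedSpace ℝ E']
  {M : Type*} [TopologicalSpace M] [ChartedSpace E' M]

/-- The Levi-Civita covariant derivative `∇_v V` at `p` of a vector field `V` along a map
`f : M → N`, in the coordinates of the chart at `f p`: the derivative of the components of `V`
in the direction `v`, plus `Γ(df v, V)`. -/
def covDerivAlong
    (g : Π x : N, TangentSpace 𝓘(ℝ, E) x →L[ℝ] TangentSpace 𝓘(ℝ, E) x →L[ℝ] ℝ)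
    (f : M → N) (V : Π p : M, TangentSpace 𝓘(ℝ, E) (f p)) (p : M) (v : TangentSpace 𝓘(ℝ, E') p) :
    TangentSpace 𝓘(ℝ, E) (f p) :=
  let comp : M → E := fun p' =>
    (trivializationAt E (TangentSpace 𝓘(ℝ, E)) (f p) (⟨f p', V p'⟩ : TangentBundle 𝓘(ℝ, E) N)).2
  (trivializationAt E (TangentSpace 𝓘(ℝ, E)) (f p)).symmL ℝ (f p) (mvfderiv 𝓘(ℝ, E') comp p v) +
    christoffel g (f p) (mfderiv 𝓘(ℝ, E') 𝓘(ℝ, E) f p v) (V p)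

/-- The Levi-Civita connection `∇_v Y` of `g` on vector fields of `N`. -/
def leviCivita
    (g : Π x : N, TangentSpace 𝓘(ℝ, E) x →L[ℝ] TangentSpace 𝓘(ℝ, E) x →L[ℝ] ℝ)
    (Y : Π x : N, TangentSpace 𝓘(ℝ, E) x) (q : N) (v : TangentSpace 𝓘(ℝ, E) q) :
    TangentSpace 𝓘(ℝ, E) q :=
  covDerivAlong g (fun x : N => x) Y q v

/-- `f : M → N` is a smooth immersion, presenting `M` as a submanifold of `N`. -/
structure IsImmersed (f : M → N) : Prop where
  smooth : ContMDiff 𝓘(ℝ, E') 𝓘(ℝ, E) ∞ f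
  injective_mfderiv : ∀ p, Function.Injective (mfderiv 𝓘(ℝ, E') 𝓘(ℝ, E) f p)

/-- The metric induced on `M` by an immersion `f : M → N` and a metric on `N`:
`(v, w) ↦ g(df v, df w)`. -/
def inducedMetric
    (g : Π x : N, TangentSpace 𝓘(ℝ, E) x →L[ℝ] TangentSpace 𝓘(ℝ, E) x →L[ℝ] ℝ)
    (f : M → N) (p : M) :
    TangentSpace 𝓘(ℝ, E') p →L[ℝ] TangentSpace 𝓘(ℝ, E') p →L[ℝ] ℝ :=
  (mfderiv 𝓘(ℝ, E') 𝓘(ℝ, E) f p).precomp ℝ ∘L g (f p) ∘L mfderiv 𝓘(ℝ, E') 𝓘(ℝ, E) f p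

/-- The component of `u ∈ T_{f p} N` normal to the submanifold: `u` minus the tangent vector `df t`
determined by `g(df t, df w) = g(u, df w)` for all `w`. -/
def normalPart
    (g : Π x : N, TangentSpace 𝓘(ℝ, E) x →L[ℝ] TangentSpace 𝓘(ℝ, E) x →L[ℝ] ℝ)
    (f : M → N) (p : M) (u : TangentSpace 𝓘(ℝ, E) (f p)) : TangentSpace 𝓘(ℝ, E) (f p) :=
  u - mfderiv 𝓘(ℝ, E') 𝓘(ℝ, E) f p
    (sharp (inducedMetric (E' := E') g f) p
      fun w => g (f p) u (mfderiv 𝓘(ℝ, E') 𝓘(ℝ, E) f p w))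

variable [IsManifold 𝓘(ℝ, E') ∞ M]

/-- The second fundamental form `h(v, w)` of the submanifold `f : M → N` (Gauss formula): the normal
component of `∇_v (df W)`, where `W` is a local vector field on `M` extending `w`.
The value does not depend on the extension; here `W` has constant components in the chart at `p`. -/
def secondFundamentalForm
    (g : Π x : N, TangentSpace 𝓘(ℝ, E) x →L[ℝ] TangentSpace 𝓘(ℝ, E) x →L[ℝ] ℝ)
    (f : M → N) (p : M) (v w : TangentSpace 𝓘(ℝ, E') p) : TangentSpace 𝓘(ℝ, E) (f p) :=
  normalPart (E' := E') g f p
    (covDerivAlong g f (fun p' => mfderiv 𝓘(ℝ, E') 𝓘(ℝ, E) f p' (FiberBundle.extend E' w p')) p v)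

/-- A submanifold is totally geodesic if its second fundamental form vanishes. -/
def IsTotallyGeodesic
    (g : Π x : N, TangentSpace 𝓘(ℝ, E) x →L[ℝ] TangentSpace 𝓘(ℝ, E) x →L[ℝ] ℝ)
    (f : M → N) : Prop :=
  ∀ (p : M) (v w : TangentSpace 𝓘(ℝ, E') p), secondFundamentalForm g f p v w = 0

end Maps

section Distributions

variable {E : Type*} [NormedAddCommGroup E] [NormedSpace ℝ E]
  {M : Type u} [TopologicalSpace M] [ChartedSpace E M] [IsManifold 𝓘(ℝ, E) ∞ M]

/-- A field of tangent subspaces is a smooth distribution: near every point it has a smooth frame. -/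
def IsSmoothDistribution (D : Π p : M, Submodule ℝ (TangentSpace 𝓘(ℝ, E) p)) : Prop :=
  ∀ p : M, ∃ U : Set M, IsOpen U ∧ p ∈ U ∧
    ∃ (k : ℕ) (X : Fin k → Π x : M, TangentSpace 𝓘(ℝ, E) x),
      (∀ i, ContMDiffOn 𝓘(ℝ, E) 𝓘(ℝ, E).tangent ∞
        (fun x => (⟨x, X i x⟩ : TangentBundle 𝓘(ℝ, E) M)) U) ∧
      ∀ x ∈ U, LinearIndependent ℝ (fun i => X i x) ∧
        Submodule.span ℝ (Set.range fun i => X i x) = D x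

/-- `j : L → M` is a connected integral manifold of the distribution `D`: an injectively immersed
connected submanifold whose tangent spaces are the spaces of `D`. -/
structure IsIntegralManifold (D : Π p : M, Submodule ℝ (TangentSpace 𝓘(ℝ, E) p)) {k : ℕ}
    {L : Type*} [TopologicalSpace L] [ChartedSpace (EuclideanSpace ℝ (Fin k)) L]
    (j : L → M) : Prop where
  connected : ConnectedSpace L
  immersed : IsImmersed (E := E) (E' := EuclideanSpace ℝ (Fin k)) j
  injective : Function.Injective j
  tangent : ∀ (l : L) (v : TangentSpace 𝓘(ℝ, E) (j l)),
    v ∈ D (j l) ↔ ∃ w, mfderiv 𝓘(ℝ, EuclideanSpace ℝ (Fin k)) 𝓘(ℝ, E) j l w = v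

/-- The distribution `D` is (completely) integrable: an integral manifold passes through every
point, so that `D` is the tangent distribution of a foliation. -/
def IsIntegrable (D : Π p : M, Submodule ℝ (TangentSpace 𝓘(ℝ, E) p)) : Prop :=
  ∀ p : M, ∃ (k : ℕ) (L : Type u) (_ : TopologicalSpace L)
    (_ : ChartedSpace (EuclideanSpace ℝ (Fin k)) L)
    (_ : IsManifold 𝓘(ℝ, EuclideanSpace ℝ (Fin k)) ∞ L) (j : L → M),
    IsIntegralManifold D (k := k) j ∧ p ∈ Set.range j

/-- The foliation tangent to the integrable distribution `D` is totally geodesic in `(M, g)`: the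
leaves, which are the maximal connected integral manifolds of `D`, are totally geodesic submanifolds.
As the second fundamental form is local and every connected integral manifold is an open piece of
a leaf, this is expressed for all connected integral manifolds. -/
def IsTotallyGeodesicFoliation
    (g : Π x : M, TangentSpace 𝓘(ℝ, E) x →L[ℝ] TangentSpace 𝓘(ℝ, E) x →L[ℝ] ℝ)
    (D : Π p : M, Submodule ℝ (TangentSpace 𝓘(ℝ, E) p)) : Prop :=
  ∀ (k : ℕ) (L : Type u) [TopologicalSpace L] [ChartedSpace (EuclideanSpace ℝ (Fin k)) L]
    [IsManifold 𝓘(ℝ, EuclideanSpace ℝ (Fin k)) ∞ L] (j : L → M),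
    IsIntegralManifold D (k := k) j → IsTotallyGeodesic (E' := EuclideanSpace ℝ (Fin k)) g j

end Distributions

section LCK

variable {E : Type*} [NormedAddCommGroup E] [NormedSpace ℝ E]
  {N : Type*} [TopologicalSpace N] [ChartedSpace E N] [IsManifold 𝓘(ℝ, E) ∞ N]

/-- `(N, J, g)` is an almost Hermitian manifold. -/
structure IsAlmostHermitian
    (g : ContMDiffRiemannianMetric 𝓘(ℝ, E) ∞ E (fun x : N => TangentSpace 𝓘(ℝ, E) x))
    (J : Π x : N, TangentSpace 𝓘(ℝ, E) x →L[ℝ] TangentSpace 𝓘(ℝ, E) x) : Prop where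
  smooth : ContMDiff 𝓘(ℝ, E) (𝓘(ℝ, E).prod 𝓘(ℝ, E →L[ℝ] E)) ∞
    (fun x => TotalSpace.mk' (E →L[ℝ] E)
      (E := fun x : N => TangentSpace 𝓘(ℝ, E) x →L[ℝ] TangentSpace 𝓘(ℝ, E) x) x (J x))
  sq : ∀ x v, J x (J x v) = -v
  compat : ∀ x v w, g.inner x (J x v) (J x w) = g.inner x v w

/-- On the open set `U`, the metric `h` is Kähler with respect to the almost complex structure `J`:
it is Hermitian and `J` is parallel, `∇_v (J Y) = J (∇_v Y)` for the Levi-Civita connection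
of `h`. -/
structure IsKahlerOn
    (h : Π x : N, TangentSpace 𝓘(ℝ, E) x →L[ℝ] TangentSpace 𝓘(ℝ, E) x →L[ℝ] ℝ)
    (J : Π x : N, TangentSpace 𝓘(ℝ, E) x →L[ℝ] TangentSpace 𝓘(ℝ, E) x) (U : Set N) : Prop where
  compat : ∀ x ∈ U, ∀ v w, h x (J x v) (J x w) = h x v w
  parallel : ∀ q ∈ U, ∀ Y : Π x : N, TangentSpace 𝓘(ℝ, E) x,
    ContMDiffAt 𝓘(ℝ, E) 𝓘(ℝ, E).tangent ∞
      (fun x => (⟨x, Y x⟩ : TangentBundle 𝓘(ℝ, E) N)) q →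
    ∀ v, leviCivita h (fun x => J x (Y x)) q v = J q (leviCivita h Y q v)

/-- `(N, J, g)` is a locally conformal Kähler manifold: an almost Hermitian manifold such that each
point has an open neighbourhood `U` and a smooth function `φ` on `U` with `exp(-φ) g` Kähler
on `U`. -/
structure IsLCK
    (g : ContMDiffRiemannianMetric 𝓘(ℝ, E) ∞ E (fun x : N => TangentSpace 𝓘(ℝ, E) x))
    (J : Π x : N, TangentSpace 𝓘(ℝ, E) x →L[ℝ] TangentSpace 𝓘(ℝ, E) x) : Prop where
  almostHermitian : IsAlmostHermitian g J
  locally_conformal : ∀ q : N, ∃ U : Set N, IsOpen U ∧ q ∈ U ∧ ∃ φ : N → ℝ,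
    ContMDiffOn 𝓘(ℝ, E) 𝓘(ℝ, ℝ) ∞ φ U ∧
    IsKahlerOn (fun x => Real.exp (-φ x) • g.inner x) J U

/-- The Kähler 2-form `Ω(X, Y) = g(X, J Y)`. -/
def kahlerForm
    (g : ContMDiffRiemannianMetric 𝓘(ℝ, E) ∞ E (fun x : N => TangentSpace 𝓘(ℝ, E) x))
    (J : Π x : N, TangentSpace 𝓘(ℝ, E) x →L[ℝ] TangentSpace 𝓘(ℝ, E) x) (x : N) :
    TangentSpace 𝓘(ℝ, E) x →L[ℝ] TangentSpace 𝓘(ℝ, E) x →L[ℝ] ℝ :=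
  (J x).precomp ℝ ∘L g.inner x

/-- `η` is the Lee form of `(N, J, g)`: a smooth closed 1-form with `dΩ = η ∧ Ω`. -/
structure IsLeeForm
    (g : ContMDiffRiemannianMetric 𝓘(ℝ, E) ∞ E (fun x : N => TangentSpace 𝓘(ℝ, E) x))
    (J : Π x : N, TangentSpace 𝓘(ℝ, E) x →L[ℝ] TangentSpace 𝓘(ℝ, E) x)
    (η : Π x : N, TangentSpace 𝓘(ℝ, E) x →L[ℝ] ℝ) : Prop where
  smooth : ContMDiff 𝓘(ℝ, E) (𝓘(ℝ, E).prod 𝓘(ℝ, E →L[ℝ] ℝ)) ∞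
    (fun x => TotalSpace.mk' (E →L[ℝ] ℝ)
      (E := fun x : N => TangentSpace 𝓘(ℝ, E) x →L[ℝ] Trivial N ℝ x) x (η x))
  closed : ∀ q a b, extDeriv₁ η q a b = 0
  extDeriv_kahlerForm : ∀ q a b c,
    extDeriv₂ (kahlerForm g J) q a b c = wedge₁₂ η (kahlerForm g J) q a b c

/-- The Lee vector field `B = η^♯`. -/
def leeVector
    (g : ContMDiffRiemannianMetric 𝓘(ℝ, E) ∞ E (fun x : N => TangentSpace 𝓘(ℝ, E) x))
    (η : Π x : N, TangentSpace 𝓘(ℝ, E) x →L[ℝ] ℝ) (x : N) : TangentSpace 𝓘(ℝ, E) x :=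
  sharp g.inner x (η x)

end LCK

section CR

variable {E : Type*} [NormedAddCommGroup E] [NormedSpace ℝ E]
  {N : Type*} [TopologicalSpace N] [ChartedSpace E N] [IsManifold 𝓘(ℝ, E) ∞ N]
  {E' : Type*} [NormedAddCommGroup E'] [NormedSpace ℝ E']
  {M : Type*} [TopologicalSpace M] [ChartedSpace E' M] [IsManifold 𝓘(ℝ, E') ∞ M]
  (g : ContMDiffRiemannianMetric 𝓘(ℝ, E) ∞ E (fun x : N => TangentSpace 𝓘(ℝ, E) x))
  (J : Π x : N, TangentSpace 𝓘(ℝ, E) x →L[ℝ] TangentSpace 𝓘(ℝ, E) x)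
  (f : M → N) (D : Π p : M, Submodule ℝ (TangentSpace 𝓘(ℝ, E') p))

/-- The vector `u ∈ T_{f p} N` is normal to the submanifold `M`. -/
def IsNormal (p : M) (u : TangentSpace 𝓘(ℝ, E) (f p)) : Prop :=
  ∀ w : TangentSpace 𝓘(ℝ, E') p, g.inner (f p) u (mfderiv 𝓘(ℝ, E') 𝓘(ℝ, E) f p w) = 0

/-- The distribution `D^⊥` on `M`: the orthogonal complement of `D` for the induced metric. -/
def orthogonalDistribution (p : M) : Submodule ℝ (TangentSpace 𝓘(ℝ, E') p) where
  carrier := {w | ∀ v ∈ D p, inducedMetric g.inner f p v w = 0}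
  add_mem' := fun ha hb v hv => by rw [map_add, ha v hv, hb v hv, add_zero]
  zero_mem' := fun v _ => map_zero _
  smul_mem' := fun c w hw v hv => by rw [map_smul, hw v hv, smul_zero]

/-- `M`, immersed in `N` by `f`, is a CR-submanifold with holomorphic distribution `D`:
`J D_p = D_p`, and `J D_p^⊥` is normal to `M`. -/
structure IsCRSubmanifold : Prop where
  immersed : IsImmersed (E := E) (E' := E') f
  smooth : IsSmoothDistribution D
  holomorphic : ∀ p : M,
    ((D p).map (mfderiv 𝓘(ℝ, E') 𝓘(ℝ, E) f p).toLinearMap).map (J (f p)).toLinearMap =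
      (D p).map (mfderiv 𝓘(ℝ, E') 𝓘(ℝ, E) f p).toLinearMap
  totally_real : ∀ p : M, ∀ w ∈ orthogonalDistribution g f D p,
    IsNormal (E' := E') g f p (J (f p) (mfderiv 𝓘(ℝ, E') 𝓘(ℝ, E) f p w))

/-- `M` is mixed geodesic: `h(X, Y) = 0` for `X` in `D` and `Y` in `D^⊥`. -/
def IsMixedGeodesic : Prop :=
  ∀ p : M, ∀ v ∈ D p, ∀ w ∈ orthogonalDistribution g f D p,
    secondFundamentalForm g.inner f p v w = 0

/-- `M` is anti-holomorphic (generic): `μ = 0`, where `μ` is the orthogonal complement of `J D^⊥` in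
the normal bundle. -/
def IsAntiHolomorphic : Prop :=
  ∀ (p : M) (u : TangentSpace 𝓘(ℝ, E) (f p)), IsNormal (E' := E') g f p u →
    (∀ w ∈ orthogonalDistribution g f D p,
      g.inner (f p) u (J (f p) (mfderiv 𝓘(ℝ, E') 𝓘(ℝ, E) f p w)) = 0) → u = 0

end CR

end

end CRGeometry

/-!
The proof rests on the 2-form `S` induced on `M` by the Kähler form `Ω`.

*The distribution.* Since `J D = D` and `J D^⊥` is normal to `M`, the distribution `D^⊥` is exactly
the kernel of `S` (`mem_orthogonalDistribution_iff`). As `dΩ = η ∧ Ω` and the Lee vector field is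
normal to `M`, the Lee form `η` vanishes on vectors tangent to `M`, so `S` is closed. The kernel of
a closed 2-form of constant rank is integrable (`exists_integral_ker`): locally it has a commuting
frame, and the integral manifolds are the solutions of a total differential equation
(`exists_hasFDerivAt_of_symmetric`). This gives `isIntegrable_orthogonalDistribution`.

*The second fundamental forms.* On a locally conformal Kähler manifold the derivatives of `Ω` are
those of a Kähler form up to terms containing the differential `δ` of the conformal exponent
(`exists_partialDeriv₂_kahlerForm`). As `(δ - η) ∧ Ω = 0`, the form `δ` agrees with `η` on the
vectors that matter, where both vanish, and the extra terms drop out. Let `j` be an integral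
manifold of `D^⊥`, let `Y` be in `D`, and write `J df Y = df X`. Differentiating `S(Y, dj w) = 0` in
the direction `dj z` yields `g(h(dj z, Y), J df (dj w)) = g(h'(z, w), X)` (`inner_covHessian_eq`),
where `h` is the second fundamental form of `M` in `N` and `h'` that of the integral manifold in
`M`. Since `h'` is orthogonal to the integral manifold, it vanishes if and only if all these
products do; and if `μ = 0`, then `h(dj z, Y)`, being normal, vanishes if and only if all its
products with `J D^⊥` do.

All computations are made in charts: a covariant derivative is a second derivative plus a
Christoffel term (`covHessian`), and the Christoffel symbols of the induced metric are the
tangential part of those of the ambient metric (`christoffel_inducedMetric`).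
-/

namespace CRGeometry

/-! ### Total differential equations -/

section TotalDifferential

open Set Metric Asymptotics Filter Topology

variable {V K : Type*} [NormedAddCommGroup V] [NormedSpace ℝ V]
  [NormedAddCommGroup K] [NormedSpace ℝ K]

/-- Picard-Lindelöf on the whole unit interval, with a solution that stays in the closed ball. -/
theorem exists_curve_mem_closedBall [CompleteSpace V] {F : V → V} {y₀ : V} {a L M : NNReal}
    (hL : LipschitzOnWith L F (closedBall y₀ a)) (hM : ∀ y ∈ closedBall y₀ a, ‖F y‖ ≤ M)
    (hMa : M ≤ a) :
    ∃ α : ℝ → V, α 0 = y₀ ∧ (∀ t ∈ Icc (0 : ℝ) 1, α t ∈ closedBall y₀ a) ∧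
      ∀ t ∈ Icc (0 : ℝ) 1, HasDerivWithinAt α (F (α t)) (Icc 0 1) t := by
  have hPL : IsPicardLindelof (fun _ => F) (⟨0, by simp⟩ : Icc (0 : ℝ) 1) y₀ a 0 M L :=
    { lipschitzOnWith := fun _ _ => hL
      continuousOn := fun _ _ => continuousOn_const
      norm_le := fun _ _ => hM
      mul_max_le := by simpa using hMa }
  have h0 : y₀ ∈ closedBall y₀ ((0 : NNReal) : ℝ) := by simp
  obtain ⟨α, hα⟩ := ODE.FunSpace.exists_isFixedPt_next hPL h0
  refine ⟨α.compProj, ?_, fun t _ => α.compProj_mem_closedBall hPL.mul_max_le, fun t ht => ?_⟩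
  · have := ODE.FunSpace.compProj_val (α := α) (t := ⟨0, by simp⟩)
    rw [this, ← hα, ODE.FunSpace.next_apply₀]
  · apply ODE.hasDerivWithinAt_picard_Icc (⟨0, by simp⟩ : Icc (0 : ℝ) 1).2 hPL.continuousOn_uncurry
      α.continuous_compProj.continuousOn (fun _ ht' ↦ α.compProj_mem_closedBall hPL.mul_max_le)
      y₀ ht |>.congr_of_mem _ ht
    intro t' ht'
    nth_rw 1 [← hα]
    rw [ODE.FunSpace.compProj_of_mem ht', ODE.FunSpace.next_apply]

theorem gronwallBound_zero_mul (K M c x : ℝ) :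
    gronwallBound 0 K (M * c) x = gronwallBound 0 K M x * c := by
  unfold gronwallBound
  split_ifs <;> ring

/-- A first-order Taylor estimate for a map with Lipschitz derivative. -/
theorem norm_sub_sub_le_of_lipschitz_fderiv {G : Type*} [NormedAddCommGroup G] [NormedSpace ℝ G]
    {A : V → G} {s : Set V} {L : NNReal} (hs : Convex ℝ s)
    (hA : ∀ y ∈ s, DifferentiableAt ℝ A y) (hL : LipschitzOnWith L (fderiv ℝ A) s)
    {u v : V} (hu : u ∈ s) (hv : v ∈ s) :
    ‖A v - A u - fderiv ℝ A u (v - u)‖ ≤ L * ‖v - u‖ ^ 2 := by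
  have hsub : segment ℝ u v ⊆ s := hs.segment_subset hu hv
  have := (convex_segment u v).norm_image_sub_le_of_norm_fderiv_le' (𝕜 := ℝ) (f := A)
    (φ := fderiv ℝ A u) (C := L * ‖v - u‖) (fun x hx => hA x (hsub hx)) (fun x hx => ?_)
    (left_mem_segment ℝ u v) (right_mem_segment ℝ u v)
  · rw [pow_two, ← mul_assoc]; exact this
  · refine (hL.norm_sub_le (hsub hx) hu).trans ?_
    gcongr
    obtain ⟨b, c, hb, hc, hbc, rfl⟩ := hx
    have : b • u + c • v - u = c • (v - u) := by
      rw [show b = 1 - c by linarith]; module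
    rw [this, norm_smul, Real.norm_of_nonneg hc]
    exact mul_le_of_le_one_left (norm_nonneg _) (by linarith)

theorem eventually_norm_lt_add_one {V G : Type*} [TopologicalSpace V] [NormedAddCommGroup G]
    {F : V → G} {y₀ : V} (hF : ContinuousAt F y₀) : ∀ᶠ y in 𝓝 y₀, ‖F y‖ < ‖F y₀‖ + 1 :=
  hF.norm.eventually_lt_const (lt_add_one _)

/-- A total differential equation `dσ = A(σ)` can be solved if `k, l ↦ dA(A k) l` is symmetric. The
solution at `x` is the value at time `1` of the integral curve of `y ↦ A y x` through `y₀`; its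
differentiability comes from Grönwall's inequality. -/
theorem exists_hasFDerivAt_of_bounds [CompleteSpace V] {A : V → K →L[ℝ] V} {y₀ : V}
    {a C C' L₁ L₂ : NNReal} (ha : 0 < a) (hC : 0 < C)
    (hd : ∀ y ∈ closedBall y₀ a, DifferentiableAt ℝ A y)
    (hAC : ∀ y ∈ closedBall y₀ a, ‖A y‖ ≤ C)
    (hAC' : ∀ y ∈ closedBall y₀ a, ‖fderiv ℝ A y‖ ≤ C')
    (hLA : LipschitzOnWith L₁ A (closedBall y₀ a))
    (hLA' : LipschitzOnWith L₂ (fderiv ℝ A) (closedBall y₀ a))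
    (hsymm : ∀ y ∈ closedBall y₀ a, ∀ k l,
      fderiv ℝ A y (A y k) l = fderiv ℝ A y (A y l) k) :
    ∃ ε > 0, ∃ σ : K → V, σ 0 = y₀ ∧
      ∀ x ∈ ball (0 : K) ε, σ x ∈ closedBall y₀ a ∧ HasFDerivAt σ (A (σ x)) x := by
  -- Curves starting at `y₀` with `x` of norm at most `ε` stay in the ball of radius `a / 2`.
  set a₂ : NNReal := a / 2 with ha₂
  set ε : NNReal := a₂ / C with hε
  have hCε : (C : ℝ) * ε = a₂ := by
    rw [← NNReal.coe_mul, hε, mul_div_cancel₀ _ hC.ne']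
  have haa : (a₂ : ℝ) + a₂ = a := by rw [← NNReal.coe_add, ha₂, add_halves]
  have hε0 : 0 < (ε : ℝ) := NNReal.coe_pos.2 (by positivity)
  have hsub : closedBall y₀ a₂ ⊆ closedBall y₀ a := closedBall_subset_closedBall (by
    linarith [a₂.coe_nonneg])
  have hcurve : ∀ x : K, ‖x‖ ≤ ε → ∃ α : ℝ → V, α 0 = y₀ ∧
      (∀ t ∈ Icc (0 : ℝ) 1, α t ∈ closedBall y₀ a₂) ∧
      ∀ t ∈ Icc (0 : ℝ) 1, HasDerivWithinAt α (A (α t) x) (Icc 0 1) t := by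
    intro x hx
    refine exists_curve_mem_closedBall (F := fun y => A y x) (L := L₁ * ‖x‖₊) (M := C * ‖x‖₊)
      ?_ ?_ ?_
    · refine LipschitzOnWith.of_dist_le_mul fun y hy z hz => ?_
      rw [dist_eq_norm, ← sub_apply]
      refine (ContinuousLinearMap.le_opNorm _ _).trans ?_
      have := hLA.norm_sub_le (hsub hy) (hsub hz)
      rw [← dist_eq_norm y z] at this
      calc ‖A y - A z‖ * ‖x‖ ≤ (L₁ * dist y z) * ‖x‖ := by gcongr
        _ = _ := by push_cast; ring
    · intro y hy
      exact (ContinuousLinearMap.le_opNorm _ _).trans (by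
        push_cast; gcongr; exact hAC y (hsub hy))
    · rw [← NNReal.coe_le_coe]
      push_cast
      calc (C : ℝ) * ‖x‖ ≤ C * ε := by gcongr
        _ = a₂ := hCε
  choose! α hα0 hαmem hαd using hcurve
  have hends : (1 : ℝ) ∈ Icc (0 : ℝ) 1 := by simp
  refine ⟨ε, hε0, fun x => α x 1, ?_, fun x hx => ?_⟩
  · -- for `x = 0` the curve has zero derivative
    have h0 : ‖(0 : K)‖ ≤ ε := by simp
    have := (convex_Icc (0 : ℝ) 1).norm_image_sub_le_of_norm_hasDerivWithin_le (C := 0)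
      (fun t ht => hαd 0 h0 t ht) (fun t _ => by simp) (by simp : (0 : ℝ) ∈ Icc (0 : ℝ) 1) hends
    simp only [zero_mul, norm_le_zero_iff, sub_eq_zero] at this
    exact this.trans (hα0 0 h0)
  have hxε : ‖x‖ < ε := mem_ball_zero_iff.1 hx
  refine ⟨hsub (hαmem x hxε.le 1 hends), ?_⟩
  set M : ℝ := C' * C + L₂ * C ^ 2 * ε
  -- Along the ray, `t ↦ α x t + t • A (α x t) h` solves the equation of `α (x + h)`
  -- up to `O(‖h‖²)`.
  have key : ∀ h : K, ‖h‖ < ε - ‖x‖ →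
      ‖α (x + h) 1 - α x 1 - A (α x 1) h‖ ≤ gronwallBound 0 (L₁ * ε : NNReal) M 1 * ‖h‖ ^ 2 := by
    intro h hh
    have hxh : ‖x + h‖ ≤ ε := (norm_add_le _ _).trans (by linarith)
    have hhε : ‖h‖ ≤ ε := by linarith [norm_nonneg x]
    have hmemu : ∀ t ∈ Icc (0 : ℝ) 1, α x t + t • A (α x t) h ∈ closedBall y₀ a := by
      intro t ht
      have h1 := hαmem x hxε.le t ht
      rw [mem_closedBall, dist_eq_norm] at h1 ⊢
      have h2 : ‖t • A (α x t) h‖ ≤ a₂ := by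
        rw [norm_smul, Real.norm_of_nonneg ht.1]
        calc t * ‖A (α x t) h‖ ≤ 1 * (C * ε) := by
              gcongr
              · exact ht.2
              · exact (ContinuousLinearMap.le_opNorm _ _).trans (by
                  gcongr; exact hAC _ (hsub (hαmem x hxε.le t ht)))
          _ = a₂ := by rw [one_mul, hCε]
      calc ‖α x t + t • A (α x t) h - y₀‖ = ‖(α x t - y₀) + t • A (α x t) h‖ := by congr 1; abel
        _ ≤ a₂ + a₂ := (norm_add_le _ _).trans (add_le_add h1 h2)
        _ = a := haa
    have hIci : ∀ t ∈ Ico (0 : ℝ) 1, Icc (0 : ℝ) 1 ∈ 𝓝[Ici t] t := fun t ht =>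
      Icc_mem_nhdsGE_of_mem ht
    have hu' : ∀ t ∈ Icc (0 : ℝ) 1, HasDerivWithinAt (fun t => α x t + t • A (α x t) h)
        (A (α x t) x + (t • fderiv ℝ A (α x t) (A (α x t) x) h + A (α x t) h)) (Icc 0 1) t := by
      intro t ht
      have hAt := ((hd _ (hsub (hαmem x hxε.le t ht))).hasFDerivAt.comp_hasDerivWithinAt t
        (hαd x hxε.le t ht)).clm_apply (hasDerivWithinAt_const t _ h)
      have := (hαd x hxε.le t ht).add ((hasDerivWithinAt_id t _).smul hAt)
      refine this.congr_deriv ?_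
      simp
    have hG := dist_le_of_approx_trajectories_ODE_of_mem
      (v := fun _ y => A y (x + h)) (s := fun _ => closedBall y₀ a) (K := L₁ * ε)
      (f := α (x + h)) (f' := fun t => A (α (x + h) t) (x + h))
      (g := fun t => α x t + t • A (α x t) h)
      (g' := fun t => A (α x t) x + (t • fderiv ℝ A (α x t) (A (α x t) x) h + A (α x t) h))
      (a := 0) (b := 1) (εf := 0) (εg := M * ‖h‖ ^ 2) (δ := 0) ?_
      (fun t ht => (hαd _ hxh t ht).continuousWithinAt)
      (fun t ht => (hαd _ hxh t (Ico_subset_Icc_self ht)).mono_of_mem_nhdsWithin (hIci t ht))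
      (fun t _ => by simp)
      (fun t ht => hsub (hαmem _ hxh t (Ico_subset_Icc_self ht)))
      (fun t ht => (hu' t ht).continuousWithinAt)
      (fun t ht => (hu' t (Ico_subset_Icc_self ht)).mono_of_mem_nhdsWithin (hIci t ht))
      ?_ (fun t ht => hmemu t (Ico_subset_Icc_self ht)) (by simp [hα0 _ hxh, hα0 _ hxε.le]) 1 hends
    · rw [zero_add, sub_zero, gronwallBound_zero_mul, dist_eq_norm, one_smul] at hG
      rw [sub_sub]
      exact hG
    · intro t ht
      refine LipschitzOnWith.of_dist_le_mul fun y hy z hz => ?_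
      rw [dist_eq_norm, ← sub_apply]
      refine (ContinuousLinearMap.le_opNorm _ _).trans ?_
      have := hLA.norm_sub_le hy hz
      rw [← dist_eq_norm y z] at this
      calc ‖A y - A z‖ * ‖x + h‖ ≤ (L₁ * dist y z) * ε := by gcongr
        _ = _ := by push_cast; ring
    · intro t ht
      have htI := Ico_subset_Icc_self ht
      have hm := hsub (hαmem x hxε.le t htI)
      set p := α x t
      have hR := norm_sub_sub_le_of_lipschitz_fderiv (convex_closedBall y₀ a)
        hd hLA' hm (hmemu t htI)
      rw [add_sub_cancel_left] at hR
      have hAh : ‖t • A p h‖ ≤ C * ‖h‖ := by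
        rw [norm_smul, Real.norm_of_nonneg ht.1]
        calc t * ‖A p h‖ ≤ 1 * (C * ‖h‖) := by
              gcongr
              · exact htI.2
              · exact (ContinuousLinearMap.le_opNorm _ _).trans (by gcongr; exact hAC _ hm)
          _ = _ := one_mul _
      have hsy := hsymm p hm x h
      rw [dist_eq_norm]
      have heq : A p x + (t • fderiv ℝ A p (A p x) h + A p h) - A (p + t • A p h) (x + h) =
          -(fderiv ℝ A p (t • A p h) h) -
            (A (p + t • A p h) - A p - fderiv ℝ A p (t • A p h)) (x + h) := by
        rw [hsy]
        simp only [sub_apply, map_add, map_smul,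
          smul_apply]
        abel
      rw [heq]
      refine (norm_sub_le _ _).trans ?_
      rw [norm_neg]
      have e1 : ‖fderiv ℝ A p (t • A p h) h‖ ≤ C' * (C * ‖h‖) * ‖h‖ := by
        refine (ContinuousLinearMap.le_opNorm _ _).trans ?_
        gcongr
        refine (ContinuousLinearMap.le_opNorm _ _).trans ?_
        gcongr
        exact hAC' _ hm
      have e2 : ‖(A (p + t • A p h) - A p - fderiv ℝ A p (t • A p h)) (x + h)‖ ≤
          L₂ * (C * ‖h‖) ^ 2 * ε := by
        refine (ContinuousLinearMap.le_opNorm _ _).trans ?_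
        gcongr
        exact hR.trans (by gcongr)
      calc _ ≤ C' * (C * ‖h‖) * ‖h‖ + L₂ * (C * ‖h‖) ^ 2 * ε := add_le_add e1 e2
        _ = M * ‖h‖ ^ 2 := by simp only [M]; ring
  have hO : (fun x' => α x' 1 - α x 1 - A (α x 1) (x' - x)) =O[𝓝 x] fun x' => ‖x' - x‖ ^ 2 := by
    refine IsBigO.of_bound (gronwallBound 0 (L₁ * ε : NNReal) M 1) ?_
    filter_upwards [Metric.ball_mem_nhds x (sub_pos.2 hxε)] with x' hx'
    have := key (x' - x) (by rwa [mem_ball, dist_eq_norm] at hx')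
    rw [add_sub_cancel] at this
    simpa using this
  have hz := hO.hasFDerivAt (𝕜 := ℝ) one_lt_two
  have hadd := (hz.add ((A (α x 1)).hasFDerivAt.comp x
    ((hasFDerivAt_id x).sub_const x))).add_const (α x 1)
  refine (hadd.congr_of_eventuallyEq (Eventually.of_forall fun x' => ?_)).congr_fderiv ?_
  · simp
  · ext; simp

set_option synthInstance.maxHeartbeats 200000 in
/-- Local solvability of the total differential equation `dσ = A(σ)` under the integrability
condition, for `A` of class `C^2`. -/
theorem exists_hasFDerivAt_of_symmetric [CompleteSpace V] {A : V → K →L[ℝ] V} {y₀ : V}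
    (hA : ContDiffAt ℝ 2 A y₀)
    (hsymm : ∀ᶠ y in 𝓝 y₀, ∀ k l, fderiv ℝ A y (A y k) l = fderiv ℝ A y (A y l) k)
    {U : Set V} (hU : U ∈ 𝓝 y₀) :
    ∃ ε > 0, ∃ σ : K → V, σ 0 = y₀ ∧
      ∀ x ∈ ball (0 : K) ε, σ x ∈ U ∧ HasFDerivAt σ (A (σ x)) x := by
  obtain ⟨L₁, s₁, hs₁, hL₁⟩ := (hA.of_le one_le_two).exists_lipschitzOnWith
  have hA' : ContDiffAt ℝ 1 (fderiv ℝ A) y₀ := hA.fderiv_right (by norm_num)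
  obtain ⟨L₂, s₂, hs₂, hL₂⟩ := hA'.exists_lipschitzOnWith
  have hd : ∀ᶠ y in 𝓝 y₀, DifferentiableAt ℝ A y :=
    ((hA.of_le one_le_two).eventually (by simp)).mono fun y hy => hy.differentiableAt one_ne_zero
  have hev : ∀ᶠ y in 𝓝 y₀, (y ∈ s₁ ∧ y ∈ s₂ ∧ y ∈ U) ∧ (‖A y‖ < ‖A y₀‖ + 1 ∧
      ‖fderiv ℝ A y‖ < ‖fderiv ℝ A y₀‖ + 1) ∧ DifferentiableAt ℝ A y ∧
      ∀ k l, fderiv ℝ A y (A y k) l = fderiv ℝ A y (A y l) k := by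
    filter_upwards [hs₁, hs₂, hU, eventually_norm_lt_add_one hA.continuousAt,
      eventually_norm_lt_add_one hA'.continuousAt, hd, hsymm] with y h1 h2 h3 h4 h5 h6 h7
    exact ⟨⟨h1, h2, h3⟩, ⟨h4, h5⟩, h6, h7⟩
  obtain ⟨a, ha, hball⟩ := Metric.nhds_basis_closedBall.eventually_iff.1 hev
  obtain ⟨ε, hε, σ, h0, hσ⟩ := exists_hasFDerivAt_of_bounds (A := A) (y₀ := y₀)
    (a := ⟨a, ha.le⟩) (C := ‖A y₀‖₊ + 1) (C' := ‖fderiv ℝ A y₀‖₊ + 1) (L₁ := L₁) (L₂ := L₂)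
    (by exact_mod_cast ha) (by positivity) (fun y hy => (hball hy).2.2.1)
    (fun y hy => (hball hy).2.1.1.le) (fun y hy => (hball hy).2.1.2.le)
    (hL₁.mono fun y hy => (hball hy).1.1) (hL₂.mono fun y hy => (hball hy).1.2.1)
    (fun y hy => (hball hy).2.2.2)
  exact ⟨ε, hε, σ, h0, fun x hx => ⟨(hball (hσ x hx).1).1.2.2, (hσ x hx).2⟩⟩

/-- Solutions of a total differential equation with smooth right-hand side are smooth. -/
theorem contDiffOn_of_hasFDerivAt_comp {A : V → K →L[ℝ] V} {σ : K → V} {s : Set K} {U : Set V}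
    (hs : IsOpen s) (hA : ContDiffOn ℝ ∞ A U) (hσU : MapsTo σ s U)
    (hσ : ∀ x ∈ s, HasFDerivAt σ (A (σ x)) x) : ContDiffOn ℝ ∞ σ s := by
  rw [contDiffOn_infty]
  intro n
  induction n with
  | zero => exact contDiffOn_zero.2 fun x hx => (hσ x hx).continuousAt.continuousWithinAt
  | succ n ih =>
    push_cast
    rw [contDiffOn_succ_iff_fderiv_of_isOpen hs]
    refine ⟨fun x hx => (hσ x hx).differentiableAt.differentiableWithinAt, by simp, ?_⟩
    exact ((hA.of_le (by exact_mod_cast le_top)).comp ih hσU).congr fun x hx => (hσ x hx).fderiv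

end TotalDifferential

/-! ### Integral manifolds of the kernel of a closed 2-form -/

theorem two_le_infty : (2 : WithTop ℕ∞) ≤ ∞ := WithTop.coe_le_coe.2 le_top

section KernelFrobenius

open Set Metric Filter Topology

variable {V : Type*} [NormedAddCommGroup V] [NormedSpace ℝ V] [FiniteDimensional ℝ V]

/-- The kernels of a smooth family of linear maps of constant rank have, locally, a smooth frame
`A` normalized by `pr ∘ A = id` for a fixed linear map `pr`. -/
theorem exists_frame_ker {G : Type*} [NormedAddCommGroup G] [NormedSpace ℝ G]
    [FiniteDimensional ℝ G] {S : V → V →L[ℝ] G} {U : Set V} (hU : IsOpen U)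
    (hS : ContDiffOn ℝ ∞ S U) {k : ℕ} (hk : ∀ y ∈ U, Module.finrank ℝ (S y).ker = k)
    {y₀ : V} (hy₀ : y₀ ∈ U) :
    ∃ (U' : Set V) (A : V → EuclideanSpace ℝ (Fin k) →L[ℝ] V)
      (pr : V →L[ℝ] EuclideanSpace ℝ (Fin k)), IsOpen U' ∧ y₀ ∈ U' ∧ U' ⊆ U ∧
      ContDiffOn ℝ ∞ A U' ∧
      ∀ y ∈ U', (∀ x, pr (A y x) = x) ∧ ∀ v, S y v = 0 ↔ ∃ x, A y x = v := by
  have hfin : Module.finrank ℝ (S y₀).ker = Module.finrank ℝ (EuclideanSpace ℝ (Fin k)) := by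
    rw [hk y₀ hy₀, finrank_euclideanSpace_fin]
  let e : (S y₀).ker ≃ₗ[ℝ] EuclideanSpace ℝ (Fin k) := LinearEquiv.ofFinrankEq _ _ hfin
  obtain ⟨p, hp⟩ := (S y₀).ker.exists_isCompl
  let pr : V →L[ℝ] EuclideanSpace ℝ (Fin k) :=
    LinearMap.toContinuousLinearMap
      (e.toLinearMap ∘ₗ Submodule.projectionOnto (S y₀).ker p hp)
  -- `v ↦ (pr v, S y v)` is injective for `y = y₀`; it is inverted, for `y` near `y₀`, with the
  -- help of a left inverse for `y = y₀`.
  let Φ : V → V →L[ℝ] EuclideanSpace ℝ (Fin k) × G := fun y => pr.prod (S y)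
  have hinj : (Φ y₀ : V →ₗ[ℝ] EuclideanSpace ℝ (Fin k) × G).ker = ⊥ := by
    rw [LinearMap.ker_eq_bot']
    intro v hv
    have h1 : pr v = 0 := congrArg Prod.fst hv
    have h2 : S y₀ v = 0 := congrArg Prod.snd hv
    have h3 : Submodule.projectionOnto (S y₀).ker p hp v = ⟨v, h2⟩ :=
      Submodule.projectionOnto_apply_left hp ⟨v, h2⟩
    have h4 : e (Submodule.projectionOnto (S y₀).ker p hp v) = 0 := h1
    rw [h3] at h4
    exact congrArg Subtype.val ((LinearEquiv.map_eq_zero_iff e).1 h4)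
  obtain ⟨Q₀, hQ₀⟩ := LinearMap.exists_leftInverse_of_injective _ hinj
  let Q : EuclideanSpace ℝ (Fin k) × G →L[ℝ] V := LinearMap.toContinuousLinearMap Q₀
  let B : V → V →L[ℝ] V := fun y => Q ∘L Φ y
  have hB₀ : B y₀ = 1 := by
    ext v
    exact congrArg (fun l => l v) hQ₀
  have hΦ : ContDiffOn ℝ ∞ Φ U := by
    rw [contDiffOn_clm_apply]
    exact fun v => contDiffOn_const.prodMk (hS.clm_apply contDiffOn_const)
  have hB : ContDiffOn ℝ ∞ B U := contDiffOn_const.clm_comp hΦ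
  let A : V → EuclideanSpace ℝ (Fin k) →L[ℝ] V := fun y =>
    Ring.inverse (B y) ∘L (Q ∘L ContinuousLinearMap.inl ℝ _ _)
  refine ⟨U ∩ B ⁻¹' {b | IsUnit b}, A, pr, hB.continuousOn.isOpen_inter_preimage hU Units.isOpen,
    ⟨hy₀, by simp [hB₀]⟩, inter_subset_left, ?_, ?_⟩
  · refine ContDiffOn.clm_comp (fun y hy => ?_) contDiffOn_const
    obtain ⟨b, hb⟩ := hy.2
    have h1 : ContDiffAt ℝ ∞ Ring.inverse (B y) := hb ▸ contDiffAt_ringInverse ℝ b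
    exact h1.comp_contDiffWithinAt y ((hB y hy.1).mono inter_subset_left)
  rintro y ⟨hyU, hyB⟩
  have hker : ∀ v, S y v = 0 → A y (pr v) = v := by
    intro v hv
    have h1 : Q (ContinuousLinearMap.inl ℝ _ _ (pr v)) = B y v := by
      simp [B, Φ, hv]
    change Ring.inverse (B y) (Q (ContinuousLinearMap.inl ℝ _ _ (pr v))) = v
    rw [h1, ← mul_apply_eq_comp, Ring.inverse_mul_cancel _ hyB]
    rfl
  -- the kernel of `S y` lies in the range of `A y`, and its dimension is at least as large
  have hle : (S y).ker ≤ (A y).range := fun v hv => ⟨pr v, hker v hv⟩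
  have hrange : Module.finrank ℝ (A y).range ≤ k :=
    (LinearMap.finrank_range_le _).trans_eq finrank_euclideanSpace_fin
  have heq : (S y).ker = (A y).range :=
    Submodule.eq_of_le_of_finrank_le hle (by rw [hk y hyU]; exact hrange)
  have hAinj : Function.Injective (A y) := by
    have h1 : Module.finrank ℝ (A y).range = k := by rw [← heq, hk y hyU]
    have h2 := LinearMap.finrank_range_add_finrank_ker (A y : EuclideanSpace ℝ (Fin k) →ₗ[ℝ] V)
    rw [finrank_euclideanSpace_fin] at h2
    have h3 : Module.finrank ℝ (A y : EuclideanSpace ℝ (Fin k) →ₗ[ℝ] V).ker = 0 := by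
      change Module.finrank ℝ (A y : EuclideanSpace ℝ (Fin k) →ₗ[ℝ] V).range = k at h1
      omega
    exact LinearMap.ker_eq_bot.1 (Submodule.finrank_eq_zero.1 h3)
  refine ⟨fun x => hAinj (hker _ ?_), fun v => ?_⟩
  · have : A y x ∈ (S y).ker := heq ▸ ⟨x, rfl⟩
    exact this
  · change v ∈ (S y).ker ↔ v ∈ (A y).range
    rw [heq]

/-- The kernel of a closed 2-form of constant rank is integrable: through every point there is a
smoothly parametrized integral manifold. Closedness is needed only with two arguments in the
kernel. -/
theorem exists_integral_ker {S : V → V →L[ℝ] V →L[ℝ] ℝ} {U : Set V} (hU : IsOpen U)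
    (hS : ContDiffOn ℝ ∞ S U) {k : ℕ} (hk : ∀ y ∈ U, Module.finrank ℝ (S y).ker = k)
    (halt : ∀ y v w, S y v w = -S y w v)
    (hinv : ∀ y ∈ U, ∀ v w, S y v = 0 → S y w = 0 → ∀ c,
      fderiv ℝ S y v w c - fderiv ℝ S y w v c + fderiv ℝ S y c v w = 0)
    {y₀ : V} (hy₀ : y₀ ∈ U) :
    ∃ ε > 0, ∃ σ : EuclideanSpace ℝ (Fin k) → V, σ 0 = y₀ ∧ ContDiffOn ℝ ∞ σ (ball 0 ε) ∧
      InjOn σ (ball 0 ε) ∧ ∀ x ∈ ball 0 ε, σ x ∈ U ∧ Function.Injective (fderiv ℝ σ x) ∧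
        ∀ v, S (σ x) v = 0 ↔ ∃ u, fderiv ℝ σ x u = v := by
  obtain ⟨U', A, pr, hU', hyU', hsub, hA, hAU⟩ := exists_frame_ker hU hS hk hy₀
  have hSd : ∀ y ∈ U', DifferentiableAt ℝ S y := fun y hy =>
    (hS.contDiffAt (hU.mem_nhds (hsub hy))).differentiableAt (by simp)
  have hAd : ∀ y ∈ U', DifferentiableAt ℝ A y := fun y hy =>
    (hA.contDiffAt (hU'.mem_nhds hy)).differentiableAt (by simp)
  have hSA : ∀ y ∈ U', ∀ x, S y (A y x) = 0 := fun y hy x => ((hAU y hy).2 _).2 ⟨x, rfl⟩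
  have hSA' : ∀ y ∈ U', ∀ a x, fderiv ℝ S y a (A y x) = -S y (fderiv ℝ A y a x) := by
    intro y hy a x
    have h1 := (hSd y hy).hasFDerivAt.clm_apply
      ((hAd y hy).hasFDerivAt.clm_apply (hasFDerivAt_const x y))
    have h2 : HasFDerivAt (fun y => S y (A y x)) (0 : V →L[ℝ] V →L[ℝ] ℝ) y :=
      (hasFDerivAt_const 0 y).congr_of_eventuallyEq
        (by filter_upwards [hU'.mem_nhds hy] with z hz using hSA z hz x)
    have h3 := congrArg (fun l => l a) (h1.unique h2)
    simp at h3
    exact eq_neg_of_add_eq_zero_right h3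
  -- the frame `A` has constant `pr`-components, so it commutes
  have hsymm : ∀ y ∈ U', ∀ x z, fderiv ℝ A y (A y x) z = fderiv ℝ A y (A y z) x := by
    intro y hy x z
    have hpr : ∀ a x, pr (fderiv ℝ A y a x) = 0 := by
      intro a x
      have h1 := pr.hasFDerivAt.comp y ((hAd y hy).hasFDerivAt.clm_apply (hasFDerivAt_const x y))
      have h2 : HasFDerivAt (pr ∘ fun y => A y x)
          (0 : V →L[ℝ] EuclideanSpace ℝ (Fin k)) y :=
        (hasFDerivAt_const x y).congr_of_eventuallyEq
          (by filter_upwards [hU'.mem_nhds hy] with w hw using (hAU w hw).1 x)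
      have h3 := congrArg (fun l => l a) (h1.unique h2)
      simpa using h3
    have hS0 : S y (fderiv ℝ A y (A y x) z - fderiv ℝ A y (A y z) x) = 0 := by
      ext c
      have h1 := hinv y (hsub hy) (A y x) (A y z) (hSA y hy x) (hSA y hy z) c
      rw [hSA' y hy, hSA' y hy, hSA' y hy] at h1
      have h2 : S y (fderiv ℝ A y c x) (A y z) = 0 := by
        rw [halt, hSA y hy]; simp
      simp only [neg_apply, h2] at h1
      simp only [map_sub, sub_apply, zero_apply]
      linarith
    obtain ⟨w, hw⟩ := ((hAU y hy).2 _).1 hS0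
    have h0 : w = 0 := by
      rw [← (hAU y hy).1 w, hw, map_sub, hpr, hpr, sub_zero]
    rw [h0, map_zero] at hw
    exact (sub_eq_zero.1 hw.symm)
  obtain ⟨ε, hε, σ, h0, hσ⟩ := exists_hasFDerivAt_of_symmetric
    ((hA.contDiffAt (hU'.mem_nhds hyU')).of_le two_le_infty)
    (by filter_upwards [hU'.mem_nhds hyU'] with y hy using hsymm y hy) (hU'.mem_nhds hyU')
  refine ⟨ε, hε, σ, h0, contDiffOn_of_hasFDerivAt_comp isOpen_ball hA (fun x hx => (hσ x hx).1)
    fun x hx => (hσ x hx).2, ?_, fun x hx => ⟨hsub (hσ x hx).1, ?_, fun v => ?_⟩⟩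
  · -- `pr ∘ σ` is the identity up to a constant
    intro x hx z hz hxz
    have hconv := convex_ball (0 : EuclideanSpace ℝ (Fin k)) ε
    have := hconv.norm_image_sub_le_of_norm_hasFDerivWithin_le (𝕜 := ℝ)
      (f := fun x => pr (σ x) - x) (f' := fun _ => 0) (C := 0) (fun y hy => ?_) (by simp) hx hz
    · rw [zero_mul, norm_le_zero_iff, hxz] at this
      simpa [sub_eq_zero] using this
    · refine HasFDerivAt.hasFDerivWithinAt ?_
      refine ((pr.hasFDerivAt.comp y (hσ y hy).2).sub (hasFDerivAt_id y)).congr_fderiv ?_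
      ext1 u
      simp [(hAU _ (hσ y hy).1).1]
  · rw [(hσ x hx).2.fderiv]
    exact Function.LeftInverse.injective (hAU _ (hσ x hx).1).1
  · rw [(hσ x hx).2.fderiv]
    exact (hAU _ (hσ x hx).1).2 v

end KernelFrobenius

noncomputable section

open Filter Topology

-- finding the norm on the space `E →L[ℝ] E →L[ℝ] ℝ` of bilinear forms exceeds the default limit
set_option synthInstance.maxHeartbeats 200000

/-! ### Tensor fields and maps in coordinates -/

theorem contDiffAt_clm_apply {D V F : Type*} [NormedAddCommGroup D] [NormedSpace ℝ D]
    [NormedAddCommGroup V] [NormedSpace ℝ V] [FiniteDimensional ℝ V] [NormedAddCommGroup F]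
    [NormedSpace ℝ F] {n : WithTop ℕ∞} {f : D → V →L[ℝ] F} {x : D}
    (h : ∀ v, ContDiffAt ℝ n (fun y => f y v) x) : ContDiffAt ℝ n f x := by
  have hd : Module.finrank ℝ V = Module.finrank ℝ (Fin (Module.finrank ℝ V) → ℝ) := by simp
  let e₁ := ContinuousLinearEquiv.ofFinrankEq hd
  let e₂ := (e₁.arrowCongr (1 : F ≃L[ℝ] F)).trans (ContinuousLinearEquiv.piRing _)
  rw [← Function.id_comp f, ← e₂.symm_comp_self]
  exact e₂.symm.contDiff.contDiffAt.comp x (contDiffAt_pi.mpr fun i => h _)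

theorem eventually_symm_mem_source {E : Type*} [NormedAddCommGroup E] [NormedSpace ℝ E]
    {N : Type*} [TopologicalSpace N] [ChartedSpace E N] (q : N) :
    ∀ᶠ u in 𝓝 (extChartAt 𝓘(ℝ, E) q q), (extChartAt 𝓘(ℝ, E) q).symm u ∈ (chartAt E q).source := by
  have h := extChartAt_target_mem_nhds (I := 𝓘(ℝ, E)) q
  filter_upwards [h] with u hu
  simpa using (extChartAt 𝓘(ℝ, E) q).map_target hu

section Coordinates

variable {E : Type*} [NormedAddCommGroup E] [NormedSpace ℝ E]
  {N : Type*} [TopologicalSpace N] [ChartedSpace E N] [IsManifold 𝓘(ℝ, E) ∞ N]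
  {E' : Type*} [NormedAddCommGroup E'] [NormedSpace ℝ E']
  {M : Type*} [TopologicalSpace M] [ChartedSpace E' M] [IsManifold 𝓘(ℝ, E') ∞ M]

/-- The frame of the chart at `q`, at the point `x`: the vector with components `b`. -/
def coordFrame (q x : N) : E →L[ℝ] TangentSpace 𝓘(ℝ, E) x :=
  (trivializationAt E (TangentSpace 𝓘(ℝ, E)) q).symmL ℝ x

/-- The components in the chart at `q` of a tangent vector at `x`. -/
def coordVector (q x : N) : TangentSpace 𝓘(ℝ, E) x →L[ℝ] E :=
  (trivializationAt E (TangentSpace 𝓘(ℝ, E)) q).continuousLinearMapAt ℝ x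

/-- The components of a covariant 2-tensor field in the chart at `q`, as a function on the
model space. -/
def coordRep (T : Π x : N, TangentSpace 𝓘(ℝ, E) x →L[ℝ] TangentSpace 𝓘(ℝ, E) x →L[ℝ] ℝ)
    (q : N) (u : E) : E →L[ℝ] E →L[ℝ] ℝ :=
  (coordFrame q ((extChartAt 𝓘(ℝ, E) q).symm u)).precomp ℝ ∘L
    T ((extChartAt 𝓘(ℝ, E) q).symm u) ∘L coordFrame q ((extChartAt 𝓘(ℝ, E) q).symm u)

theorem coordRep_apply (T : Π x : N, TangentSpace 𝓘(ℝ, E) x →L[ℝ] TangentSpace 𝓘(ℝ, E) x →L[ℝ] ℝ)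
    (q : N) (u b c : E) :
    coordRep T q u b c = T ((extChartAt 𝓘(ℝ, E) q).symm u)
      (coordFrame q ((extChartAt 𝓘(ℝ, E) q).symm u) b)
      (coordFrame q ((extChartAt 𝓘(ℝ, E) q).symm u) c) := rfl

theorem coordFrame_coordVector {q x : N} (hx : x ∈ (chartAt E q).source)
    (v : TangentSpace 𝓘(ℝ, E) x) : coordFrame q x (coordVector q x v) = v :=
  (trivializationAt E (TangentSpace 𝓘(ℝ, E)) q).symmL_continuousLinearMapAt (by simpa using hx) v

theorem coordVector_coordFrame {q x : N} (hx : x ∈ (chartAt E q).source) (b : E) :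
    coordVector q x (coordFrame q x b) = b :=
  (trivializationAt E (TangentSpace 𝓘(ℝ, E)) q).continuousLinearMapAt_symmL (by simpa using hx) b

theorem coordVector_self (q : N) (v : TangentSpace 𝓘(ℝ, E) q) :
    coordVector q q v = (show E from v) := by
  rw [coordVector, TangentBundle.continuousLinearMapAt_trivializationAt (by simp),
    mfderiv_extChartAt_self]
  rfl

theorem trivializationAt_snd {q x : N} (hx : x ∈ (chartAt E q).source)
    (v : TangentSpace 𝓘(ℝ, E) x) :
    (trivializationAt E (TangentSpace 𝓘(ℝ, E)) q (⟨x, v⟩ : TangentBundle 𝓘(ℝ, E) N)).2 =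
      coordVector q x v := by
  rw [coordVector, Trivialization.continuousLinearMapAt_apply,
    Trivialization.coe_linearMapAt_of_mem _ (by simpa using hx)]

theorem coordVector_coordFrame_self (q : N) (b : E) :
    coordVector q q (coordFrame q q b) = b :=
  coordVector_coordFrame (mem_chart_source E q) b

theorem coordFrame_coordVector_self (q : N) (v : TangentSpace 𝓘(ℝ, E) q) :
    coordFrame q q (coordVector q q v) = v :=
  coordFrame_coordVector (mem_chart_source E q) v

theorem extend_eq_coordFrame {q x : N} (hx : x ∈ (chartAt E q).source)
    (b : TangentSpace 𝓘(ℝ, E) q) :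
    FiberBundle.extend E b x = coordFrame q x (coordVector q q b) := by
  rw [FiberBundle.extend, trivializationAt_snd (mem_chart_source E q),
    coordFrame, Trivialization.symmL_apply _ (by simpa using hx)]

theorem coordRep_self (T : Π x : N, TangentSpace 𝓘(ℝ, E) x →L[ℝ] TangentSpace 𝓘(ℝ, E) x →L[ℝ] ℝ)
    (q : N) (b c : E) : coordRep T q (extChartAt 𝓘(ℝ, E) q q) b c =
      T q (coordFrame q q b) (coordFrame q q c) := by
  rw [coordRep_apply, extChartAt_to_inv]

/-- The derivative of a vector-valued function, read in the chart. -/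
theorem mvfderiv_eq_fderiv_comp_symm {F : Type*} [NormedAddCommGroup F] [NormedSpace ℝ F]
    {φ : N → F} {q : N} (h : DifferentiableAt ℝ (φ ∘ (extChartAt 𝓘(ℝ, E) q).symm)
      (extChartAt 𝓘(ℝ, E) q q)) (a : TangentSpace 𝓘(ℝ, E) q) :
    mvfderiv 𝓘(ℝ, E) φ q a =
      fderiv ℝ (φ ∘ (extChartAt 𝓘(ℝ, E) q).symm) (extChartAt 𝓘(ℝ, E) q q)
        (coordVector q q a) := by
  have hc : ContinuousAt φ q := by
    have h1 : ContinuousAt ((φ ∘ (extChartAt 𝓘(ℝ, E) q).symm) ∘ extChartAt 𝓘(ℝ, E) q) q :=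
      h.continuousAt.comp (continuousAt_extChartAt q)
    refine h1.congr ?_
    filter_upwards [extChartAt_source_mem_nhds (I := 𝓘(ℝ, E)) q] with x hx
    simp only [Function.comp_apply, (extChartAt 𝓘(ℝ, E) q).left_inv hx]
  have hm : MDifferentiableAt 𝓘(ℝ, E) 𝓘(ℝ, F) φ q := by
    rw [mdifferentiableAt_iff]
    refine ⟨hc, ?_⟩
    simpa [writtenInExtChartAt, Function.comp_def, chartAt_self_eq] using
      h.differentiableWithinAt (s := Set.univ)
  rw [hm.mvfderiv, coordVector_self]
  simp [writtenInExtChartAt, Function.comp_def, chartAt_self_eq]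
  rfl

theorem partialDeriv₂_eq
    {T : Π x : N, TangentSpace 𝓘(ℝ, E) x →L[ℝ] TangentSpace 𝓘(ℝ, E) x →L[ℝ] ℝ} {q : N}
    (hT : DifferentiableAt ℝ (coordRep T q) (extChartAt 𝓘(ℝ, E) q q))
    (a b c : TangentSpace 𝓘(ℝ, E) q) :
    partialDeriv₂ T q a b c = fderiv ℝ (coordRep T q) (extChartAt 𝓘(ℝ, E) q q)
      (coordVector q q a) (coordVector q q b) (coordVector q q c) := by
  have h1 : HasFDerivAt (fun u => coordRep T q u (coordVector q q b) (coordVector q q c)) _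
      (extChartAt 𝓘(ℝ, E) q q) :=
    (hT.hasFDerivAt.clm_apply (hasFDerivAt_const _ _)).clm_apply (hasFDerivAt_const _ _)
  have h2 : HasFDerivAt ((fun x => T x (FiberBundle.extend E b x)
      (FiberBundle.extend E c x)) ∘ (extChartAt 𝓘(ℝ, E) q).symm) _
      (extChartAt 𝓘(ℝ, E) q q) := h1.congr_of_eventuallyEq (by
    filter_upwards [eventually_symm_mem_source (E := E) q] with u hu
    simp only [Function.comp_apply]
    rw [extend_eq_coordFrame hu, extend_eq_coordFrame hu, coordRep_apply])
  rw [partialDeriv₂, mvfderiv_eq_fderiv_comp_symm h2.differentiableAt, h2.fderiv]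
  simp

/-- Smoothness of the components of a tensor field can be tested on its values on coordinate
vector fields. -/
theorem contDiffAt_coordRep [FiniteDimensional ℝ E]
    {T : Π x : N, TangentSpace 𝓘(ℝ, E) x →L[ℝ] TangentSpace 𝓘(ℝ, E) x →L[ℝ] ℝ} {q : N}
    (hT : ∀ b c : TangentSpace 𝓘(ℝ, E) q, ContMDiffAt 𝓘(ℝ, E) 𝓘(ℝ, ℝ) ∞
      (fun x => T x (FiberBundle.extend E b x) (FiberBundle.extend E c x)) q) :
    ContDiffAt ℝ ∞ (coordRep T q) (extChartAt 𝓘(ℝ, E) q q) := by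
  refine contDiffAt_clm_apply fun b => contDiffAt_clm_apply fun c => ?_
  have := hT (coordFrame q q b) (coordFrame q q c)
  rw [contMDiffAt_iff_source] at this
  simp only [modelWithCornersSelf_coe, Set.range_id, contMDiffWithinAt_univ,
    contMDiffAt_iff_contDiffAt] at this
  refine this.congr_of_eventuallyEq ?_
  filter_upwards [eventually_symm_mem_source (E := E) q] with u hu
  simp only [Function.comp_apply]
  rw [extend_eq_coordFrame hu, extend_eq_coordFrame hu, coordRep_apply,
    coordVector_coordFrame_self, coordVector_coordFrame_self]

theorem mdifferentiableAt_extChartAt_symm {p : M} {y : E'}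
    (hy : y ∈ (extChartAt 𝓘(ℝ, E') p).target) :
    MDifferentiableAt 𝓘(ℝ, E') 𝓘(ℝ, E') (extChartAt 𝓘(ℝ, E') p).symm y := by
  have := mdifferentiableWithinAt_extChartAt_symm (I := 𝓘(ℝ, E')) hy
  rwa [modelWithCornersSelf_coe, Set.range_id, mdifferentiableWithinAt_univ] at this

/-- The derivative of a map, read in charts, gives the components of its differential in the
coordinate frames. -/
theorem eventually_coordFrame_fderiv {f : M → N} {p : M}
    (hf : ContMDiffAt 𝓘(ℝ, E') 𝓘(ℝ, E) 2 f p) :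
    ∀ᶠ y in 𝓝 (extChartAt 𝓘(ℝ, E') p p),
      (extChartAt 𝓘(ℝ, E') p).symm y ∈ (chartAt E' p).source ∧
      f ((extChartAt 𝓘(ℝ, E') p).symm y) ∈ (chartAt E (f p)).source ∧
      (extChartAt 𝓘(ℝ, E) (f p)).symm (writtenInExtChartAt 𝓘(ℝ, E') 𝓘(ℝ, E) p f y) =
        f ((extChartAt 𝓘(ℝ, E') p).symm y) ∧
      ∀ b : E', fderiv ℝ (writtenInExtChartAt 𝓘(ℝ, E') 𝓘(ℝ, E) p f) y b =
        coordVector (f p) (f ((extChartAt 𝓘(ℝ, E') p).symm y))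
          (mfderiv 𝓘(ℝ, E') 𝓘(ℝ, E) f ((extChartAt 𝓘(ℝ, E') p).symm y)
            (coordFrame p ((extChartAt 𝓘(ℝ, E') p).symm y) b)) := by
  have hsymm : Tendsto (extChartAt 𝓘(ℝ, E') p).symm (𝓝 (extChartAt 𝓘(ℝ, E') p p)) (𝓝 p) := by
    have := continuousAt_extChartAt_symm (I := 𝓘(ℝ, E')) p
    rwa [ContinuousAt, extChartAt_to_inv] at this
  have h1 := hsymm.eventually ((contMDiffAt_iff_contMDiffAt_nhds (by simp)).1 hf)
  have h2 := hsymm.eventually (hf.continuousAt.eventually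
    ((chartAt E (f p)).open_source.mem_nhds (mem_chart_source E (f p))))
  filter_upwards [extChartAt_target_mem_nhds (I := 𝓘(ℝ, E')) p, h1, h2,
    eventually_symm_mem_source (E := E') p] with y hy hfy hsrc hys
  refine ⟨hys, hsrc, ?_, fun b => ?_⟩
  · exact (extChartAt 𝓘(ℝ, E) (f p)).left_inv (by rwa [extChartAt_source])
  · have hd1 := mdifferentiableAt_extChartAt_symm hy
    have hd2 := hfy.mdifferentiableAt (by simp)
    have hd3 := mdifferentiableAt_extChartAt (I := 𝓘(ℝ, E)) hsrc
    have h4 := mfderiv_comp y hd3 (hd2.comp y hd1)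
    have h5 := mfderiv_comp y hd2 hd1
    rw [← mfderiv_eq_fderiv]
    have h6 : coordFrame p ((extChartAt 𝓘(ℝ, E') p).symm y) b =
        mfderiv 𝓘(ℝ, E') 𝓘(ℝ, E') (extChartAt 𝓘(ℝ, E') p).symm y b := by
      rw [coordFrame, TangentBundle.symmL_trivializationAt hys,
        (extChartAt 𝓘(ℝ, E') p).right_inv hy, modelWithCornersSelf_coe, Set.range_id,
        mfderivWithin_univ]
      rfl
    have h7 : coordVector (f p) (f ((extChartAt 𝓘(ℝ, E') p).symm y)) =
        mfderiv 𝓘(ℝ, E) 𝓘(ℝ, E) (extChartAt 𝓘(ℝ, E) (f p))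
          (f ((extChartAt 𝓘(ℝ, E') p).symm y)) := by
      rw [coordVector, TangentBundle.continuousLinearMapAt_trivializationAt hsrc]
    rw [h6, h7]
    have h8 := congrArg (fun l => l b) h4
    have h9 := congrArg (fun l => l b) h5
    exact h8.trans (congrArg _ h9)

end Coordinates

/-! ### Derivatives of pulled back tensor fields -/

section Coordinates

variable {E : Type*} [NormedAddCommGroup E] [NormedSpace ℝ E]
  {N : Type*} [TopologicalSpace N] [ChartedSpace E N]
  {E' : Type*} [NormedAddCommGroup E'] [NormedSpace ℝ E']
  {M : Type*} [TopologicalSpace M] [ChartedSpace E' M]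

theorem contDiffAt_writtenInExtChartAt {n : WithTop ℕ∞} {f : M → N} {p : M}
    (hf : ContMDiffAt 𝓘(ℝ, E') 𝓘(ℝ, E) n f p) :
    ContDiffAt ℝ n (writtenInExtChartAt 𝓘(ℝ, E') 𝓘(ℝ, E) p f) (extChartAt 𝓘(ℝ, E') p p) := by
  have := (contMDiffAt_iff.1 hf).2
  rwa [modelWithCornersSelf_coe, Set.range_id, contDiffWithinAt_univ] at this

theorem writtenInExtChartAt_self {f : M → N} (p : M) :
    writtenInExtChartAt 𝓘(ℝ, E') 𝓘(ℝ, E) p f (extChartAt 𝓘(ℝ, E') p p) =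
      extChartAt 𝓘(ℝ, E) (f p) (f p) := by
  simp [writtenInExtChartAt]

variable [IsManifold 𝓘(ℝ, E) ∞ N]

theorem fderiv_coordRep_comp
    {T : Π x : N, TangentSpace 𝓘(ℝ, E) x →L[ℝ] TangentSpace 𝓘(ℝ, E) x →L[ℝ] ℝ}
    {f : M → N} {p : M} (hf : ContMDiffAt 𝓘(ℝ, E') 𝓘(ℝ, E) 2 f p)
    (hT : DifferentiableAt ℝ (coordRep T (f p)) (extChartAt 𝓘(ℝ, E) (f p) (f p))) :
    DifferentiableAt ℝ (fun y => coordRep T (f p)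
      (writtenInExtChartAt 𝓘(ℝ, E') 𝓘(ℝ, E) p f y)) (extChartAt 𝓘(ℝ, E') p p) ∧
    ∀ a, fderiv ℝ (fun y => coordRep T (f p)
      (writtenInExtChartAt 𝓘(ℝ, E') 𝓘(ℝ, E) p f y)) (extChartAt 𝓘(ℝ, E') p p) a =
      fderiv ℝ (coordRep T (f p)) (extChartAt 𝓘(ℝ, E) (f p) (f p))
        (fderiv ℝ (writtenInExtChartAt 𝓘(ℝ, E') 𝓘(ℝ, E) p f) (extChartAt 𝓘(ℝ, E') p p) a) := by
  have hτ1 := (contDiffAt_writtenInExtChartAt hf).differentiableAt (by simp)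
  rw [← writtenInExtChartAt_self (E' := E') (f := f) p] at hT
  refine ⟨DifferentiableAt.comp (G := E →L[ℝ] E →L[ℝ] ℝ) (g := coordRep T (f p)) _ hT hτ1,
    fun a => ?_⟩
  have := fderiv_comp (G := E →L[ℝ] E →L[ℝ] ℝ) (g := coordRep T (f p)) _ hT hτ1
  rw [writtenInExtChartAt_self] at this
  exact congrArg (fun l => l a) this

variable [IsManifold 𝓘(ℝ, E') ∞ M]

theorem mfderiv_eq_coordFrame {f : M → N} {p : M}
    (hf : ContMDiffAt 𝓘(ℝ, E') 𝓘(ℝ, E) 2 f p) (v : TangentSpace 𝓘(ℝ, E') p) :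
    mfderiv 𝓘(ℝ, E') 𝓘(ℝ, E) f p v = coordFrame (f p) (f p)
      (fderiv ℝ (writtenInExtChartAt 𝓘(ℝ, E') 𝓘(ℝ, E) p f) (extChartAt 𝓘(ℝ, E') p p)
        (coordVector p p v)) := by
  have h := (eventually_coordFrame_fderiv hf).self_of_nhds.2.2.2 (coordVector p p v)
  rw [extChartAt_to_inv] at h
  rw [h, coordFrame_coordVector_self, coordFrame_coordVector_self]

/-- The components of a pulled back tensor field. -/
theorem eventually_coordRep_inducedMetric
    (T : Π x : N, TangentSpace 𝓘(ℝ, E) x →L[ℝ] TangentSpace 𝓘(ℝ, E) x →L[ℝ] ℝ)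
    {f : M → N} {p : M} (hf : ContMDiffAt 𝓘(ℝ, E') 𝓘(ℝ, E) 2 f p) :
    ∀ᶠ y in 𝓝 (extChartAt 𝓘(ℝ, E') p p), coordRep (inducedMetric T f) p y =
      ((fderiv ℝ (writtenInExtChartAt 𝓘(ℝ, E') 𝓘(ℝ, E) p f) y).precomp ℝ ∘L
        coordRep T (f p) (writtenInExtChartAt 𝓘(ℝ, E') 𝓘(ℝ, E) p f y) ∘L
          fderiv ℝ (writtenInExtChartAt 𝓘(ℝ, E') 𝓘(ℝ, E) p f) y) := by
  filter_upwards [eventually_coordFrame_fderiv hf] with y hy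
  obtain ⟨h1, h2, h3, h4⟩ := hy
  ext b c
  rw [coordRep_apply]
  change _ = coordRep T (f p) (writtenInExtChartAt 𝓘(ℝ, E') 𝓘(ℝ, E) p f y)
    (fderiv ℝ (writtenInExtChartAt 𝓘(ℝ, E') 𝓘(ℝ, E) p f) y b)
    (fderiv ℝ (writtenInExtChartAt 𝓘(ℝ, E') 𝓘(ℝ, E) p f) y c)
  rw [coordRep_apply, h4, h4, h3, coordFrame_coordVector h2, coordFrame_coordVector h2]
  rfl

theorem hasFDerivAt_apply₂ {V W : Type*} [NormedAddCommGroup V] [NormedSpace ℝ V]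
    [NormedAddCommGroup W] [NormedSpace ℝ W] {A : V → W →L[ℝ] W →L[ℝ] ℝ} {v w : V → W} {x : V}
    (hA : DifferentiableAt ℝ A x) (hv : DifferentiableAt ℝ v x) (hw : DifferentiableAt ℝ w x) :
    DifferentiableAt ℝ (fun y => A y (v y) (w y)) x ∧
    ∀ a, fderiv ℝ (fun y => A y (v y) (w y)) x a =
      fderiv ℝ A x a (v x) (w x) + A x (fderiv ℝ v x a) (w x) + A x (v x) (fderiv ℝ w x a) := by
  have h := (hA.hasFDerivAt.clm_apply hv.hasFDerivAt).clm_apply hw.hasFDerivAt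
  refine ⟨h.differentiableAt, fun a => ?_⟩
  rw [h.fderiv]
  simp
  ring

theorem contDiffAt_coordRep_inducedMetric {n m : WithTop ℕ∞} (hnm : m + 1 ≤ n) (hn : 2 ≤ n)
    {T : Π x : N, TangentSpace 𝓘(ℝ, E) x →L[ℝ] TangentSpace 𝓘(ℝ, E) x →L[ℝ] ℝ}
    {f : M → N} {p : M} (hf : ContMDiffAt 𝓘(ℝ, E') 𝓘(ℝ, E) n f p)
    (hT : ContDiffAt ℝ m (coordRep T (f p)) (extChartAt 𝓘(ℝ, E) (f p) (f p))) :
    ContDiffAt ℝ m (coordRep (inducedMetric T f) p) (extChartAt 𝓘(ℝ, E') p p) := by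
  have hτ := contDiffAt_writtenInExtChartAt hf
  have hτ' := hτ.fderiv_right hnm
  refine ContDiffAt.congr_of_eventuallyEq ?_ (eventually_coordRep_inducedMetric T (hf.of_le hn))
  have h1 : ContDiffAt ℝ m (fun y => coordRep T (f p)
      (writtenInExtChartAt 𝓘(ℝ, E') 𝓘(ℝ, E) p f y)) (extChartAt 𝓘(ℝ, E') p p) := by
    rw [← writtenInExtChartAt_self (E' := E') (f := f) p] at hT
    exact hT.comp _ (hτ.of_le (le_self_add.trans hnm))
  have h2 : ContDiffAt ℝ m (fun y => (ContinuousLinearMap.compL ℝ E' E ℝ).flip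
      (fderiv ℝ (writtenInExtChartAt 𝓘(ℝ, E') 𝓘(ℝ, E) p f) y)) (extChartAt 𝓘(ℝ, E') p p) :=
    (ContinuousLinearMap.contDiff _).contDiffAt.comp _ hτ'
  exact h2.clm_comp (h1.clm_comp hτ')

/-- The vector of second derivatives `∂_a ∂_b f` of a map, in the charts at `p` and `f p`. -/
def coordHessian (f : M → N) (p : M) (a b : TangentSpace 𝓘(ℝ, E') p) : TangentSpace 𝓘(ℝ, E) (f p) :=
  coordFrame (f p) (f p) (fderiv ℝ (fderiv ℝ (writtenInExtChartAt 𝓘(ℝ, E') 𝓘(ℝ, E) p f))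
    (extChartAt 𝓘(ℝ, E') p p) (coordVector p p a) (coordVector p p b))

theorem coordHessian_symm {f : M → N} {p : M} (hf : ContMDiffAt 𝓘(ℝ, E') 𝓘(ℝ, E) 2 f p)
    (a b : TangentSpace 𝓘(ℝ, E') p) :
    coordHessian (E := E) f p a b = coordHessian (E := E) f p b a := by
  have h := (contDiffAt_writtenInExtChartAt hf).isSymmSndFDerivAt (by simp)
  rw [coordHessian, coordHessian, h.eq]

/-- The derivative of a pulled back tensor field. -/
theorem partialDeriv₂_inducedMetric
    {T : Π x : N, TangentSpace 𝓘(ℝ, E) x →L[ℝ] TangentSpace 𝓘(ℝ, E) x →L[ℝ] ℝ}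
    {f : M → N} {p : M} (hf : ContMDiffAt 𝓘(ℝ, E') 𝓘(ℝ, E) 2 f p)
    (hT : DifferentiableAt ℝ (coordRep T (f p)) (extChartAt 𝓘(ℝ, E) (f p) (f p)))
    (a b c : TangentSpace 𝓘(ℝ, E') p) :
    partialDeriv₂ (inducedMetric T f) p a b c =
      partialDeriv₂ T (f p) (mfderiv 𝓘(ℝ, E') 𝓘(ℝ, E) f p a) (mfderiv 𝓘(ℝ, E') 𝓘(ℝ, E) f p b)
        (mfderiv 𝓘(ℝ, E') 𝓘(ℝ, E) f p c) +
      T (f p) (coordHessian f p a b) (mfderiv 𝓘(ℝ, E') 𝓘(ℝ, E) f p c) +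
      T (f p) (mfderiv 𝓘(ℝ, E') 𝓘(ℝ, E) f p b) (coordHessian f p a c) := by
  have hτ := contDiffAt_writtenInExtChartAt hf
  have hτ2 : DifferentiableAt ℝ (fderiv ℝ (writtenInExtChartAt 𝓘(ℝ, E') 𝓘(ℝ, E) p f))
      (extChartAt 𝓘(ℝ, E') p p) :=
    (hτ.fderiv_right (m := 1) (by norm_num)).differentiableAt (by simp)
  obtain ⟨hT1, hT2⟩ := fderiv_coordRep_comp hf hT
  have hev := eventually_coordRep_inducedMetric T hf
  have hv : ∀ b : E', DifferentiableAt ℝ (fun y => fderiv ℝ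
      (writtenInExtChartAt 𝓘(ℝ, E') 𝓘(ℝ, E) p f) y b) (extChartAt 𝓘(ℝ, E') p p) := fun b =>
    hτ2.clm_apply (differentiableAt_const b)
  have hv' : ∀ a b : E', fderiv ℝ (fun y => fderiv ℝ
      (writtenInExtChartAt 𝓘(ℝ, E') 𝓘(ℝ, E) p f) y b) (extChartAt 𝓘(ℝ, E') p p) a =
      fderiv ℝ (fderiv ℝ (writtenInExtChartAt 𝓘(ℝ, E') 𝓘(ℝ, E) p f))
        (extChartAt 𝓘(ℝ, E') p p) a b := by
    intro a b
    rw [(hτ2.hasFDerivAt.clm_apply (hasFDerivAt_const b _)).fderiv]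
    simp
  obtain ⟨hd, hd'⟩ := hasFDerivAt_apply₂ hT1 (hv (coordVector p p b)) (hv (coordVector p p c))
  have hfun : ((fun x => inducedMetric T f x (FiberBundle.extend E' b x)
      (FiberBundle.extend E' c x)) ∘ (extChartAt 𝓘(ℝ, E') p).symm) =ᶠ[𝓝 (extChartAt 𝓘(ℝ, E') p p)]
      fun y => coordRep T (f p) (writtenInExtChartAt 𝓘(ℝ, E') 𝓘(ℝ, E) p f y)
        (fderiv ℝ (writtenInExtChartAt 𝓘(ℝ, E') 𝓘(ℝ, E) p f) y (coordVector p p b))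
        (fderiv ℝ (writtenInExtChartAt 𝓘(ℝ, E') 𝓘(ℝ, E) p f) y (coordVector p p c)) := by
    filter_upwards [hev, eventually_symm_mem_source (E := E') p] with y hy hys
    have := congrArg (fun l => l (coordVector p p b) (coordVector p p c)) hy
    refine Eq.trans ?_ this
    simp only [Function.comp_apply]
    rw [extend_eq_coordFrame hys, extend_eq_coordFrame hys, coordRep_apply]
  rw [partialDeriv₂, mvfderiv_eq_fderiv_comp_symm (hd.congr_of_eventuallyEq hfun), hfun.fderiv_eq,
    hd', hT2, hv', hv', partialDeriv₂_eq hT,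
    mfderiv_eq_coordFrame hf, mfderiv_eq_coordFrame hf, mfderiv_eq_coordFrame hf]
  simp only [coordVector_coordFrame_self]
  rw [writtenInExtChartAt_self, coordRep_self, coordRep_self, coordHessian, coordHessian]

end Coordinates

/-! ### Christoffel symbols of the induced metric -/

section Connection

variable {E : Type*} [NormedAddCommGroup E] [NormedSpace ℝ E]
  {N : Type*} [TopologicalSpace N] [ChartedSpace E N] [IsManifold 𝓘(ℝ, E) ∞ N]
  {E' : Type*} [NormedAddCommGroup E'] [NormedSpace ℝ E']
  {M : Type*} [TopologicalSpace M] [ChartedSpace E' M] [IsManifold 𝓘(ℝ, E') ∞ M]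

theorem christoffel_spec [FiniteDimensional ℝ E]
    {T : Π x : N, TangentSpace 𝓘(ℝ, E) x →L[ℝ] TangentSpace 𝓘(ℝ, E) x →L[ℝ] ℝ} {q : N}
    (hT : DifferentiableAt ℝ (coordRep T q) (extChartAt 𝓘(ℝ, E) q q))
    (hpos : ∀ v : TangentSpace 𝓘(ℝ, E) q, v ≠ 0 → 0 < T q v v)
    (a b c : TangentSpace 𝓘(ℝ, E) q) :
    T q (christoffel T q a b) c =
      (partialDeriv₂ T q a b c + partialDeriv₂ T q b a c - partialDeriv₂ T q c a b) / 2 := by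
  let α : TangentSpace 𝓘(ℝ, E) q →ₗ[ℝ] ℝ :=
    { toFun := fun c =>
        (partialDeriv₂ T q a b c + partialDeriv₂ T q b a c - partialDeriv₂ T q c a b) / 2
      map_add' := fun c d => by
        simp only [partialDeriv₂_eq hT, map_add, add_apply]
        ring
      map_smul' := fun r c => by
        simp only [partialDeriv₂_eq hT, map_smul, smul_apply, smul_eq_mul, RingHom.id_apply]
        ring }
  exact sharp_spec T q hpos α c

theorem partialDeriv₂_symm
    {T : Π x : N, TangentSpace 𝓘(ℝ, E) x →L[ℝ] TangentSpace 𝓘(ℝ, E) x →L[ℝ] ℝ}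
    (hT : ∀ x v w, T x v w = T x w v) (q : N) (a b c : TangentSpace 𝓘(ℝ, E) q) :
    partialDeriv₂ T q a b c = partialDeriv₂ T q a c b := by
  unfold partialDeriv₂
  congr 2
  ext x
  rw [hT]

theorem christoffel_symm
    {T : Π x : N, TangentSpace 𝓘(ℝ, E) x →L[ℝ] TangentSpace 𝓘(ℝ, E) x →L[ℝ] ℝ}
    (hT : ∀ x v w, T x v w = T x w v) (q : N) (a b : TangentSpace 𝓘(ℝ, E) q) :
    christoffel T q a b = christoffel T q b a := by
  unfold christoffel
  congr 1
  ext c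
  rw [partialDeriv₂_symm hT q c a b]
  ring

/-- In coordinates, `∇_v (df W)` consists of the second derivatives of `f` and a
Christoffel term. -/
theorem covDerivAlong_mfderiv
    (T : Π x : N, TangentSpace 𝓘(ℝ, E) x →L[ℝ] TangentSpace 𝓘(ℝ, E) x →L[ℝ] ℝ)
    {f : M → N} {p : M} (hf : ContMDiffAt 𝓘(ℝ, E') 𝓘(ℝ, E) 2 f p)
    (v w : TangentSpace 𝓘(ℝ, E') p) :
    covDerivAlong T f (fun p' => mfderiv 𝓘(ℝ, E') 𝓘(ℝ, E) f p' (FiberBundle.extend E' w p')) p v =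
      coordHessian f p v w +
        christoffel T (f p) (mfderiv 𝓘(ℝ, E') 𝓘(ℝ, E) f p v) (mfderiv 𝓘(ℝ, E') 𝓘(ℝ, E) f p w) := by
  have hτ2 : DifferentiableAt ℝ (fderiv ℝ (writtenInExtChartAt 𝓘(ℝ, E') 𝓘(ℝ, E) p f))
      (extChartAt 𝓘(ℝ, E') p p) :=
    ((contDiffAt_writtenInExtChartAt hf).fderiv_right (m := 1) (by norm_num)).differentiableAt
      (by simp)
  have h1 := hτ2.hasFDerivAt.clm_apply (hasFDerivAt_const (coordVector p p w) _)
  have h2 : HasFDerivAt ((fun p' : M => (trivializationAt E (TangentSpace 𝓘(ℝ, E)) (f p)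
      (⟨f p', mfderiv 𝓘(ℝ, E') 𝓘(ℝ, E) f p' (FiberBundle.extend E' w p')⟩ :
        TangentBundle 𝓘(ℝ, E) N)).2) ∘ (extChartAt 𝓘(ℝ, E') p).symm) _
      (extChartAt 𝓘(ℝ, E') p p) := h1.congr_of_eventuallyEq (by
    filter_upwards [eventually_coordFrame_fderiv hf] with y hy
    obtain ⟨hy1, hy2, -, hy4⟩ := hy
    simp only [Function.comp_apply]
    rw [trivializationAt_snd hy2, extend_eq_coordFrame hy1, hy4])
  rw [covDerivAlong, mvfderiv_eq_fderiv_comp_symm h2.differentiableAt, h2.fderiv,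
    FiberBundle.extend_apply_self]
  unfold coordHessian coordFrame
  simp only [ContinuousLinearMap.comp_zero, zero_add, ContinuousLinearMap.flip_apply]

/-- The Levi-Civita connection of the induced metric is the tangential part of that of the ambient
metric. -/
theorem christoffel_inducedMetric [FiniteDimensional ℝ E] [FiniteDimensional ℝ E']
    {g : Π x : N, TangentSpace 𝓘(ℝ, E) x →L[ℝ] TangentSpace 𝓘(ℝ, E) x →L[ℝ] ℝ}
    (hsymm : ∀ x v w, g x v w = g x w v)
    (hpos : ∀ x, ∀ v : TangentSpace 𝓘(ℝ, E) x, v ≠ 0 → 0 < g x v v)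
    {f : M → N} {p : M} (hf : ContMDiffAt 𝓘(ℝ, E') 𝓘(ℝ, E) 2 f p)
    (hinj : Function.Injective (mfderiv 𝓘(ℝ, E') 𝓘(ℝ, E) f p))
    (hg : ContDiffAt ℝ 1 (coordRep g (f p)) (extChartAt 𝓘(ℝ, E) (f p) (f p)))
    (a b c : TangentSpace 𝓘(ℝ, E') p) :
    inducedMetric g f p (christoffel (inducedMetric g f) p a b) c =
      g (f p) (coordHessian f p a b + christoffel g (f p) (mfderiv 𝓘(ℝ, E') 𝓘(ℝ, E) f p a)
        (mfderiv 𝓘(ℝ, E') 𝓘(ℝ, E) f p b)) (mfderiv 𝓘(ℝ, E') 𝓘(ℝ, E) f p c) := by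
  have hd := hg.differentiableAt one_ne_zero
  have hd' := (contDiffAt_coordRep_inducedMetric (n := 2) (m := 1) (by norm_num) le_rfl hf
    hg).differentiableAt one_ne_zero
  rw [christoffel_spec hd', map_add, add_apply, christoffel_spec hd (hpos _),
    partialDeriv₂_inducedMetric hf hd, partialDeriv₂_inducedMetric hf hd,
    partialDeriv₂_inducedMetric hf hd, coordHessian_symm hf b a, coordHessian_symm hf c a,
    coordHessian_symm hf c b,
    hsymm _ (mfderiv 𝓘(ℝ, E') 𝓘(ℝ, E) f p b) (coordHessian f p a c),
    hsymm _ (mfderiv 𝓘(ℝ, E') 𝓘(ℝ, E) f p a) (coordHessian f p b c)]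
  · ring
  · intro v hv
    exact hpos _ _ fun h => hv (hinj (h.trans (map_zero _).symm))

end Connection

/-! ### The Kähler form of a locally conformal Kähler manifold -/

section LocallyConformalKahler

variable {E : Type*} [NormedAddCommGroup E] [NormedSpace ℝ E]
  {N : Type*} [TopologicalSpace N] [ChartedSpace E N] [IsManifold 𝓘(ℝ, E) ∞ N]
  {g : ContMDiffRiemannianMetric 𝓘(ℝ, E) ∞ E (fun x : N => TangentSpace 𝓘(ℝ, E) x)}
  {J : Π x : N, TangentSpace 𝓘(ℝ, E) x →L[ℝ] TangentSpace 𝓘(ℝ, E) x}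

theorem kahlerForm_apply (x : N) (v w : TangentSpace 𝓘(ℝ, E) x) :
    kahlerForm g J x v w = g.inner x v (J x w) := rfl

theorem IsAlmostHermitian.inner_J (h : IsAlmostHermitian g J) (x : N)
    (v w : TangentSpace 𝓘(ℝ, E) x) : g.inner x v (J x w) = -g.inner x w (J x v) := by
  rw [← h.compat, h.sq, map_neg, g.symm]

theorem contDiffAt_coordRep_inner [FiniteDimensional ℝ E] (q : N) :
    ContDiffAt ℝ ∞ (coordRep g.inner q) (extChartAt 𝓘(ℝ, E) q q) := by
  refine contDiffAt_coordRep fun b c => ?_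
  have : ContMDiffAt 𝓘(ℝ, E) (𝓘(ℝ, E).prod 𝓘(ℝ, ℝ)) ∞
      (fun x => TotalSpace.mk' ℝ (E := Bundle.Trivial N ℝ) x
        (g.inner x (FiberBundle.extend E b x) (FiberBundle.extend E c x))) q := by
    apply ContMDiffAt.clm_bundle_apply₂ (F₁ := E) (F₂ := E)
    · exact g.contMDiff q
    · exact FiberBundle.contMDiffAt_extend _ _ _
    · exact FiberBundle.contMDiffAt_extend _ _ _
  simp only [contMDiffAt_totalSpace] at this
  exact this.2

theorem contMDiffAt_J_extend (h : IsAlmostHermitian g J) (q : N) (c : TangentSpace 𝓘(ℝ, E) q) :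
    ContMDiffAt 𝓘(ℝ, E) 𝓘(ℝ, E).tangent ∞
      (fun x => (⟨x, J x (FiberBundle.extend E c x)⟩ : TangentBundle 𝓘(ℝ, E) N)) q := by
  apply ContMDiffAt.clm_bundle_apply (F₁ := E) (F₂ := E)
  · exact h.smooth q
  · exact FiberBundle.contMDiffAt_extend _ _ _

theorem contDiffAt_coordRep_kahlerForm [FiniteDimensional ℝ E] (h : IsAlmostHermitian g J) (q : N) :
    ContDiffAt ℝ ∞ (coordRep (kahlerForm g J) q) (extChartAt 𝓘(ℝ, E) q q) := by
  refine contDiffAt_coordRep fun b c => ?_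
  have : ContMDiffAt 𝓘(ℝ, E) (𝓘(ℝ, E).prod 𝓘(ℝ, ℝ)) ∞
      (fun x => TotalSpace.mk' ℝ (E := Bundle.Trivial N ℝ) x
        (g.inner x (FiberBundle.extend E b x) (J x (FiberBundle.extend E c x)))) q := by
    apply ContMDiffAt.clm_bundle_apply₂ (F₁ := E) (F₂ := E)
    · exact g.contMDiff q
    · exact FiberBundle.contMDiffAt_extend _ _ _
    · exact contMDiffAt_J_extend h q c
  simp only [contMDiffAt_totalSpace] at this
  exact this.2

/-- The components in the chart at `q` of the vector field obtained by applying `J` to the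
coordinate vector field with components `c`. -/
def coordJ (J : Π x : N, TangentSpace 𝓘(ℝ, E) x →L[ℝ] TangentSpace 𝓘(ℝ, E) x) (q : N) (c u : E) :
    E :=
  coordVector q ((extChartAt 𝓘(ℝ, E) q).symm u) (J ((extChartAt 𝓘(ℝ, E) q).symm u)
    (coordFrame q ((extChartAt 𝓘(ℝ, E) q).symm u) c))

theorem eventually_coordJ (J : Π x : N, TangentSpace 𝓘(ℝ, E) x →L[ℝ] TangentSpace 𝓘(ℝ, E) x)
    (q : N) (c : TangentSpace 𝓘(ℝ, E) q) :
    ((fun x => (trivializationAt E (TangentSpace 𝓘(ℝ, E)) q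
      (⟨x, J x (FiberBundle.extend E c x)⟩ : TangentBundle 𝓘(ℝ, E) N)).2) ∘
        (extChartAt 𝓘(ℝ, E) q).symm) =ᶠ[𝓝 (extChartAt 𝓘(ℝ, E) q q)]
      coordJ J q (coordVector q q c) := by
  filter_upwards [eventually_symm_mem_source (E := E) q] with u hu
  simp only [Function.comp_apply]
  rw [trivializationAt_snd hu, extend_eq_coordFrame hu]
  rfl

theorem differentiableAt_coordJ (h : IsAlmostHermitian g J) (q : N) (c : E) :
    DifferentiableAt ℝ (coordJ J q c) (extChartAt 𝓘(ℝ, E) q q) := by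
  have h1 := contMDiffAt_J_extend h q (coordFrame q q c)
  rw [contMDiffAt_totalSpace] at h1
  have h2 := h1.2
  rw [contMDiffAt_iff_source] at h2
  simp only [modelWithCornersSelf_coe, Set.range_id, contMDiffWithinAt_univ,
    contMDiffAt_iff_contDiffAt] at h2
  have h3 := (h2.congr_of_eventuallyEq
    (eventually_coordJ J q (coordFrame q q c)).symm).differentiableAt (by simp)
  rwa [coordVector_coordFrame_self] at h3

/-- The derivative `(∂_a J) c` at `q`, in the chart at `q`. -/
def partialDerivJ (J : Π x : N, TangentSpace 𝓘(ℝ, E) x →L[ℝ] TangentSpace 𝓘(ℝ, E) x) (q : N)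
    (a c : TangentSpace 𝓘(ℝ, E) q) : TangentSpace 𝓘(ℝ, E) q :=
  coordFrame q q (fderiv ℝ (coordJ J q (coordVector q q c)) (extChartAt 𝓘(ℝ, E) q q)
    (coordVector q q a))

/-- The product rule for `Ω(b, c) = g(b, J c)`. -/
theorem partialDeriv₂_kahlerForm [FiniteDimensional ℝ E] (h : IsAlmostHermitian g J) (q : N)
    (a b c : TangentSpace 𝓘(ℝ, E) q) :
    partialDeriv₂ (kahlerForm g J) q a b c =
      partialDeriv₂ g.inner q a b (J q c) + g.inner q b (partialDerivJ J q a c) := by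
  have hg := (contDiffAt_coordRep_inner (g := g) q).differentiableAt (by simp)
  have hJ := differentiableAt_coordJ h q (coordVector q q c)
  obtain ⟨hd, hd'⟩ := hasFDerivAt_apply₂ hg (differentiableAt_const (coordVector q q b)) hJ
  have hfun : ((fun x => kahlerForm g J x (FiberBundle.extend E b x)
      (FiberBundle.extend E c x)) ∘ (extChartAt 𝓘(ℝ, E) q).symm) =ᶠ[𝓝 (extChartAt 𝓘(ℝ, E) q q)]
      fun u => coordRep g.inner q u (coordVector q q b) (coordJ J q (coordVector q q c) u) := by
    filter_upwards [eventually_symm_mem_source (E := E) q] with u hu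
    simp only [Function.comp_apply]
    rw [extend_eq_coordFrame hu, extend_eq_coordFrame hu, coordRep_apply, kahlerForm_apply, coordJ,
      coordFrame_coordVector hu]
  rw [partialDeriv₂, mvfderiv_eq_fderiv_comp_symm (hd.congr_of_eventuallyEq hfun), hfun.fderiv_eq,
    hd', partialDeriv₂_eq hg, coordRep_self, coordRep_self, coordFrame_coordVector_self]
  have h0 : coordJ J q (coordVector q q c) (extChartAt 𝓘(ℝ, E) q q) = coordVector q q (J q c) := by
    rw [coordJ, extChartAt_to_inv, coordFrame_coordVector_self]
  rw [h0, partialDerivJ]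
  simp

/-- The Levi-Civita derivative of coordinate vector fields is given by the Christoffel symbols. -/
theorem leviCivita_extend
    (T : Π x : N, TangentSpace 𝓘(ℝ, E) x →L[ℝ] TangentSpace 𝓘(ℝ, E) x →L[ℝ] ℝ)
    (q : N) (a c : TangentSpace 𝓘(ℝ, E) q) :
    leviCivita T (fun x => FiberBundle.extend E c x) q a = christoffel T q a c := by
  have hfun : ((fun x => (trivializationAt E (TangentSpace 𝓘(ℝ, E)) q
      (⟨x, FiberBundle.extend E c x⟩ : TangentBundle 𝓘(ℝ, E) N)).2) ∘
        (extChartAt 𝓘(ℝ, E) q).symm) =ᶠ[𝓝 (extChartAt 𝓘(ℝ, E) q q)]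
      fun _ => coordVector q q c := by
    filter_upwards [eventually_symm_mem_source (E := E) q] with u hu
    simp only [Function.comp_apply]
    rw [trivializationAt_snd hu, extend_eq_coordFrame hu, coordVector_coordFrame hu]
  have hd := (differentiableAt_const (𝕜 := ℝ) (coordVector q q c)).congr_of_eventuallyEq hfun
  rw [leviCivita, covDerivAlong, mvfderiv_eq_fderiv_comp_symm hd, hfun.fderiv_eq,
    FiberBundle.extend_apply_self]
  have hid : mfderiv 𝓘(ℝ, E) 𝓘(ℝ, E) (fun x : N => x) q a = a :=
    congrArg (fun l => l a) (mfderiv_id (I := 𝓘(ℝ, E)) (x := q))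
  rw [hid]
  simp

theorem leviCivita_J_extend (h : IsAlmostHermitian g J)
    (T : Π x : N, TangentSpace 𝓘(ℝ, E) x →L[ℝ] TangentSpace 𝓘(ℝ, E) x →L[ℝ] ℝ)
    (q : N) (a c : TangentSpace 𝓘(ℝ, E) q) :
    leviCivita T (fun x => J x (FiberBundle.extend E c x)) q a =
      partialDerivJ J q a c + christoffel T q a (J q c) := by
  have hfun := eventually_coordJ J q c
  have hd := (differentiableAt_coordJ h q (coordVector q q c)).congr_of_eventuallyEq hfun
  rw [leviCivita, covDerivAlong, mvfderiv_eq_fderiv_comp_symm hd, hfun.fderiv_eq,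
    FiberBundle.extend_apply_self]
  have hid : mfderiv 𝓘(ℝ, E) 𝓘(ℝ, E) (fun x : N => x) q a = a :=
    congrArg (fun l => l a) (mfderiv_id (I := 𝓘(ℝ, E)) (x := q))
  rw [hid]
  rfl

/-- The product rule, with the differentiability and the derivative stated together; it is applied
to bilinear forms, where `IsBoundedSMul` is not found by instance search. -/
theorem fderiv_real_smul {V F : Type*} [NormedAddCommGroup V] [NormedSpace ℝ V]
    [NormedAddCommGroup F] [NormedSpace ℝ F] {r : V → ℝ} {A : V → F} {x : V}
    (hr : DifferentiableAt ℝ r x) (hA : DifferentiableAt ℝ A x) :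
    DifferentiableAt ℝ (fun y => r y • A y) x ∧
      fderiv ℝ (fun y => r y • A y) x = r x • fderiv ℝ A x + (fderiv ℝ r x).smulRight (A x) :=
  ⟨hr.smul hA, fderiv_fun_smul hr hA⟩

theorem partialDeriv₂_smul
    {T : Π x : N, TangentSpace 𝓘(ℝ, E) x →L[ℝ] TangentSpace 𝓘(ℝ, E) x →L[ℝ] ℝ} {q : N}
    (hT : DifferentiableAt ℝ (coordRep T q) (extChartAt 𝓘(ℝ, E) q q))
    {ψ : N → ℝ} (hψ : DifferentiableAt ℝ (ψ ∘ (extChartAt 𝓘(ℝ, E) q).symm)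
      (extChartAt 𝓘(ℝ, E) q q)) :
    DifferentiableAt ℝ (coordRep (fun x => ψ x • T x) q) (extChartAt 𝓘(ℝ, E) q q) ∧
    ∀ a b c, partialDeriv₂ (fun x => ψ x • T x) q a b c =
      fderiv ℝ (ψ ∘ (extChartAt 𝓘(ℝ, E) q).symm) (extChartAt 𝓘(ℝ, E) q q) (coordVector q q a) *
        T q b c + ψ q * partialDeriv₂ T q a b c := by
  have hfun : coordRep (fun x => ψ x • T x) q =
      fun u => (ψ ∘ (extChartAt 𝓘(ℝ, E) q).symm) u • coordRep T q u := by
    ext u b c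
    rfl
  have hd : DifferentiableAt ℝ (coordRep (fun x => ψ x • T x) q) (extChartAt 𝓘(ℝ, E) q q) := by
    rw [hfun]
    exact (fderiv_real_smul (F := E →L[ℝ] E →L[ℝ] ℝ) hψ hT).1
  refine ⟨hd, fun a b c => ?_⟩
  have hsmul := (fderiv_real_smul (F := E →L[ℝ] E →L[ℝ] ℝ) hψ hT).2
  rw [partialDeriv₂_eq hd, hfun, partialDeriv₂_eq hT]
  refine (congrArg (fun l => l (coordVector q q a) (coordVector q q b) (coordVector q q c))
    hsmul).trans ?_
  have h0 : T q b c = coordRep T q (extChartAt 𝓘(ℝ, E) q q) (coordVector q q b)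
      (coordVector q q c) := by
    rw [coordRep_self, coordFrame_coordVector_self, coordFrame_coordVector_self]
  rw [h0]
  simp
  ring

/-- On a locally conformal Kähler manifold, the derivative of the Kähler form is expressed by the
Christoffel symbols and the differential `δ` of the conformal exponent: the terms with `δ` measure
the failure of `J` to be parallel. -/
theorem exists_partialDeriv₂_kahlerForm [FiniteDimensional ℝ E] (h : IsLCK g J) (q : N) :
    ∃ δ : TangentSpace 𝓘(ℝ, E) q →L[ℝ] ℝ, ∀ a b c, partialDeriv₂ (kahlerForm g J) q a b c =
      g.inner q (christoffel g.inner q a b) (J q c) -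
      g.inner q (christoffel g.inner q a c) (J q b) +
      (δ c * g.inner q a (J q b) - δ (J q b) * g.inner q a c + δ (J q c) * g.inner q a b -
        δ b * g.inner q a (J q c)) / 2 := by
  have hH := h.almostHermitian
  obtain ⟨U, hU, hqU, φ, hφ, hK⟩ := h.locally_conformal q
  have hg := (contDiffAt_coordRep_inner (g := g) q).differentiableAt (by simp)
  -- the conformal factor and its derivative
  have hφ1 := (hφ q hqU).contMDiffAt (hU.mem_nhds hqU)
  rw [contMDiffAt_iff_source] at hφ1
  simp only [modelWithCornersSelf_coe, Set.range_id, contMDiffWithinAt_univ,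
    contMDiffAt_iff_contDiffAt] at hφ1
  have hφ2 := (hφ1.differentiableAt (by simp)).hasFDerivAt
  have hψ : HasFDerivAt ((fun x => Real.exp (-φ x)) ∘ (extChartAt 𝓘(ℝ, E) q).symm) _
      (extChartAt 𝓘(ℝ, E) q q) := hφ2.neg.exp
  set δ₀ := fderiv ℝ (φ ∘ (extChartAt 𝓘(ℝ, E) q).symm) (extChartAt 𝓘(ℝ, E) q q) with hδ₀
  obtain ⟨hd, hd'⟩ := partialDeriv₂_smul hg hψ.differentiableAt
  have hpos : 0 < Real.exp (-φ q) := Real.exp_pos _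
  have hdT : ∀ a b c, partialDeriv₂ (fun x => Real.exp (-φ x) • g.inner x) q a b c =
      Real.exp (-φ q) * (partialDeriv₂ g.inner q a b c -
        δ₀ (coordVector q q a) * g.inner q b c) := by
    intro a b c
    rw [hd', hψ.fderiv]
    simp
    ring
  -- the Christoffel symbols of the conformal metric
  have hsp : ∀ a b c, g.inner q (christoffel (fun x => Real.exp (-φ x) • g.inner x) q a b) c =
      g.inner q (christoffel g.inner q a b) c - (δ₀ (coordVector q q a) * g.inner q b c +
        δ₀ (coordVector q q b) * g.inner q a c - δ₀ (coordVector q q c) * g.inner q a b) / 2 := by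
    intro a b c
    have h1 := christoffel_spec hd (fun v hv => mul_pos hpos (g.pos q v hv)) a b c
    have h2 := christoffel_spec hg (g.pos q) a b c
    rw [hdT, hdT, hdT] at h1
    have h3 : Real.exp (-φ q) *
        g.inner q (christoffel (fun x => Real.exp (-φ x) • g.inner x) q a b) c = _ := h1
    rw [h2]
    apply mul_left_cancel₀ hpos.ne'
    rw [h3]
    ring
  refine ⟨δ₀ ∘L coordVector q q, fun a b c => ?_⟩
  have hpar := hK.parallel q hqU (fun x => FiberBundle.extend E c x)
    (FiberBundle.contMDiffAt_extend _ _ _) a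
  rw [leviCivita_J_extend hH, leviCivita_extend] at hpar
  have hJ' := eq_sub_of_add_eq hpar
  rw [partialDeriv₂_kahlerForm hH, hJ', map_sub, hH.inner_J q b, g.symm q b, hsp, hsp]
  have h1 := christoffel_spec hg (g.pos q) a b (J q c)
  have h2 := christoffel_spec hg (g.pos q) a (J q c) b
  have h3 := partialDeriv₂_symm g.symm q a b (J q c)
  simp only [ContinuousLinearMap.comp_apply]
  rw [partialDeriv₂_symm g.symm q (J q c) a b] at h1
  rw [partialDeriv₂_symm g.symm q (J q c) a b] at h2
  rw [hH.inner_J q c b, g.symm q (J q c) b]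
  linarith

end LocallyConformalKahler

/-! ### The second fundamental form and the induced 2-form of a CR-submanifold -/

section SecondFundamentalForm

variable {E : Type*} [NormedAddCommGroup E] [NormedSpace ℝ E]
  {N : Type*} [TopologicalSpace N] [ChartedSpace E N]
  {E' : Type*} [NormedAddCommGroup E'] [NormedSpace ℝ E']
  {M : Type*} [TopologicalSpace M] [ChartedSpace E' M]

theorem inducedMetric_apply
    (g : Π x : N, TangentSpace 𝓘(ℝ, E) x →L[ℝ] TangentSpace 𝓘(ℝ, E) x →L[ℝ] ℝ)
    (f : M → N) (p : M) (v w : TangentSpace 𝓘(ℝ, E') p) :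
    inducedMetric g f p v w =
      g (f p) (mfderiv 𝓘(ℝ, E') 𝓘(ℝ, E) f p v) (mfderiv 𝓘(ℝ, E') 𝓘(ℝ, E) f p w) := rfl

theorem inducedMetric_pos
    {g : Π x : N, TangentSpace 𝓘(ℝ, E) x →L[ℝ] TangentSpace 𝓘(ℝ, E) x →L[ℝ] ℝ}
    (hpos : ∀ x, ∀ v : TangentSpace 𝓘(ℝ, E) x, v ≠ 0 → 0 < g x v v) {f : M → N} {p : M}
    (hinj : Function.Injective (mfderiv 𝓘(ℝ, E') 𝓘(ℝ, E) f p))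
    (v : TangentSpace 𝓘(ℝ, E') p) (hv : v ≠ 0) : 0 < inducedMetric g f p v v :=
  hpos _ _ fun h => hv (hinj (h.trans (map_zero _).symm))

/-- Taking the normal part does not affect the product with normal vectors. -/
theorem normalPart_apply
    (g : Π x : N, TangentSpace 𝓘(ℝ, E) x →L[ℝ] TangentSpace 𝓘(ℝ, E) x →L[ℝ] ℝ) {f : M → N} {p : M}
    (u : TangentSpace 𝓘(ℝ, E) (f p)) {n : TangentSpace 𝓘(ℝ, E) (f p)}
    (hn : ∀ w : TangentSpace 𝓘(ℝ, E') p, g (f p) (mfderiv 𝓘(ℝ, E') 𝓘(ℝ, E) f p w) n = 0) :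
    g (f p) (normalPart (E' := E') g f p u) n = g (f p) u n := by
  rw [normalPart, map_sub, sub_apply, hn, sub_zero]

/-- The normal part of a vector is orthogonal to the submanifold. -/
theorem normalPart_mfderiv [FiniteDimensional ℝ E']
    {g : Π x : N, TangentSpace 𝓘(ℝ, E) x →L[ℝ] TangentSpace 𝓘(ℝ, E) x →L[ℝ] ℝ}
    (hpos : ∀ x, ∀ v : TangentSpace 𝓘(ℝ, E) x, v ≠ 0 → 0 < g x v v) {f : M → N} {p : M}
    (hinj : Function.Injective (mfderiv 𝓘(ℝ, E') 𝓘(ℝ, E) f p))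
    (u : TangentSpace 𝓘(ℝ, E) (f p)) (w : TangentSpace 𝓘(ℝ, E') p) :
    g (f p) (normalPart (E' := E') g f p u) (mfderiv 𝓘(ℝ, E') 𝓘(ℝ, E) f p w) = 0 := by
  have h := sharp_spec (inducedMetric (E' := E') g f) p (inducedMetric_pos hpos hinj)
    (g (f p) u ∘L mfderiv 𝓘(ℝ, E') 𝓘(ℝ, E) f p).toLinearMap w
  rw [inducedMetric_apply] at h
  rw [normalPart, map_sub, sub_apply, sub_eq_zero]
  exact h.symm

variable [IsManifold 𝓘(ℝ, E) ∞ N] [IsManifold 𝓘(ℝ, E') ∞ M]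

/-- The covariant derivative `∇_v (df W)`, where `W` is the local vector field on `M` with constant
components extending `w`, in the coordinates of the charts at `p` and `f p`. -/
def covHessian (g : Π x : N, TangentSpace 𝓘(ℝ, E) x →L[ℝ] TangentSpace 𝓘(ℝ, E) x →L[ℝ] ℝ)
    (f : M → N) (p : M) (v w : TangentSpace 𝓘(ℝ, E') p) : TangentSpace 𝓘(ℝ, E) (f p) :=
  coordHessian f p v w +
    christoffel g (f p) (mfderiv 𝓘(ℝ, E') 𝓘(ℝ, E) f p v) (mfderiv 𝓘(ℝ, E') 𝓘(ℝ, E) f p w)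

theorem secondFundamentalForm_eq
    (g : Π x : N, TangentSpace 𝓘(ℝ, E) x →L[ℝ] TangentSpace 𝓘(ℝ, E) x →L[ℝ] ℝ)
    {f : M → N} {p : M} (hf : ContMDiffAt 𝓘(ℝ, E') 𝓘(ℝ, E) 2 f p)
    (v w : TangentSpace 𝓘(ℝ, E') p) :
    secondFundamentalForm g f p v w = normalPart (E' := E') g f p (covHessian g f p v w) := by
  rw [secondFundamentalForm, covDerivAlong_mfderiv g hf, covHessian]

theorem secondFundamentalForm_symm
    {g : Π x : N, TangentSpace 𝓘(ℝ, E) x →L[ℝ] TangentSpace 𝓘(ℝ, E) x →L[ℝ] ℝ}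
    (hg : ∀ x v w, g x v w = g x w v)
    {f : M → N} {p : M} (hf : ContMDiffAt 𝓘(ℝ, E') 𝓘(ℝ, E) 2 f p)
    (v w : TangentSpace 𝓘(ℝ, E') p) :
    secondFundamentalForm g f p v w = secondFundamentalForm g f p w v := by
  rw [secondFundamentalForm_eq g hf, secondFundamentalForm_eq g hf, covHessian, covHessian,
    coordHessian_symm hf, christoffel_symm hg]

/-- If `T(v, ·)` vanishes on the tangent spaces of the submanifold for every `v`, the derivatives of
`T` in tangent directions, with a tangent second argument, are determined by `T` and the second
derivatives of `f`. -/
theorem partialDeriv₂_add_coordHessian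
    {T : Π x : N, TangentSpace 𝓘(ℝ, E) x →L[ℝ] TangentSpace 𝓘(ℝ, E) x →L[ℝ] ℝ}
    {f : M → N} {p : M} (hf : ContMDiffAt 𝓘(ℝ, E') 𝓘(ℝ, E) 2 f p)
    (hT : DifferentiableAt ℝ (coordRep T (f p)) (extChartAt 𝓘(ℝ, E) (f p) (f p)))
    (h0 : ∀ x v w, T (f x) v (mfderiv 𝓘(ℝ, E') 𝓘(ℝ, E) f x w) = 0)
    (a c : TangentSpace 𝓘(ℝ, E') p) (b : TangentSpace 𝓘(ℝ, E) (f p)) :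
    partialDeriv₂ T (f p) (mfderiv 𝓘(ℝ, E') 𝓘(ℝ, E) f p a) b (mfderiv 𝓘(ℝ, E') 𝓘(ℝ, E) f p c) +
      T (f p) b (coordHessian f p a c) = 0 := by
  have hτ := contDiffAt_writtenInExtChartAt hf
  have hτ2 : DifferentiableAt ℝ (fderiv ℝ (writtenInExtChartAt 𝓘(ℝ, E') 𝓘(ℝ, E) p f))
      (extChartAt 𝓘(ℝ, E') p p) :=
    (hτ.fderiv_right (m := 1) (by norm_num)).differentiableAt (by simp)
  obtain ⟨hT1, hT2⟩ := fderiv_coordRep_comp hf hT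
  have hv := hτ2.hasFDerivAt.clm_apply (hasFDerivAt_const (coordVector p p c) _)
  obtain ⟨hd, hd'⟩ := hasFDerivAt_apply₂ hT1
    (differentiableAt_const (coordVector (f p) (f p) b)) hv.differentiableAt
  have hfun : (fun y => coordRep T (f p) (writtenInExtChartAt 𝓘(ℝ, E') 𝓘(ℝ, E) p f y)
      (coordVector (f p) (f p) b) (fderiv ℝ (writtenInExtChartAt 𝓘(ℝ, E') 𝓘(ℝ, E) p f) y
        (coordVector p p c))) =ᶠ[𝓝 (extChartAt 𝓘(ℝ, E') p p)] fun _ => 0 := by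
    filter_upwards [eventually_coordFrame_fderiv hf] with y hy
    obtain ⟨h1, h2, h3, h4⟩ := hy
    rw [coordRep_apply, h4, h3, coordFrame_coordVector h2]
    exact h0 _ _ _
  have h := hd' (coordVector p p a)
  rw [hfun.fderiv_eq, hT2, hv.fderiv] at h
  rw [partialDeriv₂_eq hT, mfderiv_eq_coordFrame hf, mfderiv_eq_coordFrame hf,
    coordVector_coordFrame_self, coordVector_coordFrame_self, coordHessian]
  have h5 : T (f p) b = T (f p) (coordFrame (f p) (f p) (coordVector (f p) (f p) b)) := by
    rw [coordFrame_coordVector_self]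
  rw [h5, ← coordRep_self]
  rw [writtenInExtChartAt_self] at h
  simpa using h.symm

end SecondFundamentalForm

section CR

variable {E : Type*} [NormedAddCommGroup E] [NormedSpace ℝ E]
  {N : Type*} [TopologicalSpace N] [ChartedSpace E N] [IsManifold 𝓘(ℝ, E) ∞ N]
  {E' : Type*} [NormedAddCommGroup E'] [NormedSpace ℝ E']
  {M : Type*} [TopologicalSpace M] [ChartedSpace E' M]
  {g : ContMDiffRiemannianMetric 𝓘(ℝ, E) ∞ E (fun x : N => TangentSpace 𝓘(ℝ, E) x)}
  {J : Π x : N, TangentSpace 𝓘(ℝ, E) x →L[ℝ] TangentSpace 𝓘(ℝ, E) x}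
  {η : Π x : N, TangentSpace 𝓘(ℝ, E) x →L[ℝ] ℝ}
  {f : M → N} {D : Π p : M, Submodule ℝ (TangentSpace 𝓘(ℝ, E') p)}

theorem lee_mfderiv_eq_zero [FiniteDimensional ℝ E] {p : M}
    (hB : IsNormal (E' := E') g f p (leeVector g η (f p))) (w : TangentSpace 𝓘(ℝ, E') p) :
    η (f p) (mfderiv 𝓘(ℝ, E') 𝓘(ℝ, E) f p w) = 0 :=
  (sharp_spec g.inner (f p) (g.pos _) (η (f p)).toLinearMap _).symm.trans (hB w)

theorem inducedMetric_kahlerForm_antisymm (h : IsAlmostHermitian g J) (p : M)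
    (v w : TangentSpace 𝓘(ℝ, E') p) : inducedMetric (kahlerForm g J) f p v w =
      -inducedMetric (kahlerForm g J) f p w v := by
  rw [inducedMetric_apply, inducedMetric_apply, kahlerForm_apply, kahlerForm_apply, h.inner_J]

variable [IsManifold 𝓘(ℝ, E') ∞ M]

theorem IsCRSubmanifold.exists_J_eq (h : IsCRSubmanifold g J f D) {p : M}
    {v : TangentSpace 𝓘(ℝ, E') p} (hv : v ∈ D p) :
    ∃ w ∈ D p, mfderiv 𝓘(ℝ, E') 𝓘(ℝ, E) f p w = J (f p) (mfderiv 𝓘(ℝ, E') 𝓘(ℝ, E) f p v) := by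
  have h1 : J (f p) (mfderiv 𝓘(ℝ, E') 𝓘(ℝ, E) f p v) ∈
      ((D p).map (mfderiv 𝓘(ℝ, E') 𝓘(ℝ, E) f p).toLinearMap).map (J (f p)).toLinearMap :=
    ⟨_, ⟨v, hv, rfl⟩, rfl⟩
  rw [h.holomorphic p] at h1
  exact h1

theorem IsCRSubmanifold.exists_eq_J (h : IsCRSubmanifold g J f D) {p : M}
    {v : TangentSpace 𝓘(ℝ, E') p} (hv : v ∈ D p) :
    ∃ w ∈ D p, mfderiv 𝓘(ℝ, E') 𝓘(ℝ, E) f p v = J (f p) (mfderiv 𝓘(ℝ, E') 𝓘(ℝ, E) f p w) := by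
  have h1 : mfderiv 𝓘(ℝ, E') 𝓘(ℝ, E) f p v ∈
      (D p).map (mfderiv 𝓘(ℝ, E') 𝓘(ℝ, E) f p).toLinearMap := ⟨v, hv, rfl⟩
  rw [← h.holomorphic p] at h1
  obtain ⟨-, ⟨w, hw, rfl⟩, h2⟩ := h1
  exact ⟨w, hw, h2.symm⟩

/-- The distribution `D^⊥` is the kernel of the induced 2-form. -/
theorem mem_orthogonalDistribution_iff (h : IsAlmostHermitian g J) (hM : IsCRSubmanifold g J f D)
    {p : M} {w : TangentSpace 𝓘(ℝ, E') p} : w ∈ orthogonalDistribution g f D p ↔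
      ∀ v, inducedMetric (kahlerForm g J) f p w v = 0 := by
  refine ⟨fun hw v => ?_, fun hw v hv => ?_⟩
  · rw [inducedMetric_apply, kahlerForm_apply, h.inner_J, g.symm, hM.totally_real p w hw v,
      neg_zero]
  · obtain ⟨u, -, hu⟩ := hM.exists_eq_J hv
    rw [inducedMetric_apply, hu, g.symm]
    exact hw u

/-- The differential of the conformal exponent and the Lee form agree on vectors `X` for which
there is a `Z ≠ 0` orthogonal to `X` and `J X`. -/
theorem conformal_eq_lee (h : IsAlmostHermitian g J) {q : N}
    (hη : ∀ a b c, extDeriv₂ (kahlerForm g J) q a b c = wedge₁₂ η (kahlerForm g J) q a b c)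
    {δ : TangentSpace 𝓘(ℝ, E) q →L[ℝ] ℝ}
    (hδ : ∀ a b c, partialDeriv₂ (kahlerForm g J) q a b c =
      g.inner q (christoffel g.inner q a b) (J q c) -
      g.inner q (christoffel g.inner q a c) (J q b) +
      (δ c * g.inner q a (J q b) - δ (J q b) * g.inner q a c + δ (J q c) * g.inner q a b -
        δ b * g.inner q a (J q c)) / 2)
    {X Z : TangentSpace 𝓘(ℝ, E) q} (hZ : Z ≠ 0) (hXZ : g.inner q X Z = 0)
    (hXJZ : g.inner q X (J q Z) = 0) : δ X = η q X := by
  have h1 := hη X Z (J q Z)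
  have hs := christoffel_symm g.symm q
  have hZZ := g.pos q Z hZ
  have e1 : g.inner q (J q Z) X = 0 := by rw [g.symm, hXJZ]
  have e2 : g.inner q (J q Z) (J q X) = 0 := by rw [h.compat, g.symm, hXZ]
  have e3 : g.inner q Z X = 0 := by rw [g.symm, hXZ]
  have e4 : g.inner q Z (J q X) = 0 := by rw [h.inner_J, hXJZ, neg_zero]
  have e5 : g.inner q Z (J q Z) = 0 := by
    have := h.inner_J q Z Z
    linarith
  have e6 : g.inner q (J q Z) Z = 0 := by rw [g.symm, e5]
  simp only [extDeriv₂, wedge₁₂, hδ, kahlerForm_apply, h.sq, map_neg, hs (J q Z), hs Z X, e1, e2,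
    e3, e4, e5, e6, hXZ, hXJZ, h.compat, mul_zero, mul_neg, neg_zero] at h1
  have h2 : δ X * g.inner q Z Z = η q X * g.inner q Z Z := by linarith
  exact mul_right_cancel₀ hZZ.ne' h2

/-- When the Lee vector field is normal, the derivative of the induced 2-form in the directions of
`D^⊥` is given by the Levi-Civita connections of `N` and `M` as on a Kähler manifold. -/
theorem partialDeriv₂_inducedMetric_kahlerForm [FiniteDimensional ℝ E] [FiniteDimensional ℝ E']
    (hN : IsLCK g J) (hη : IsLeeForm g J η) (hM : IsCRSubmanifold g J f D) {p : M}
    (hB : IsNormal (E' := E') g f p (leeVector g η (f p)))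
    {Z W X Y : TangentSpace 𝓘(ℝ, E') p} (hZ : Z ∈ orthogonalDistribution g f D p)
    (hW : W ∈ orthogonalDistribution g f D p) (hX : X ∈ D p) (hY : Y ∈ D p)
    (hXY : mfderiv 𝓘(ℝ, E') 𝓘(ℝ, E) f p X = J (f p) (mfderiv 𝓘(ℝ, E') 𝓘(ℝ, E) f p Y)) :
    partialDeriv₂ (inducedMetric (kahlerForm g J) f) p Z Y W =
      g.inner (f p) (covHessian g.inner f p Z Y) (J (f p) (mfderiv 𝓘(ℝ, E') 𝓘(ℝ, E) f p W)) -
      inducedMetric g.inner f p (christoffel (inducedMetric g.inner f) p Z W) X := by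
  have hH := hN.almostHermitian
  have hf : ContMDiffAt 𝓘(ℝ, E') 𝓘(ℝ, E) 2 f p := hM.immersed.smooth.contMDiffAt.of_le two_le_infty
  obtain ⟨δ, hδ⟩ := exists_partialDeriv₂_kahlerForm hN (f p)
  have hYZ := hZ Y hY
  have hXZ := hZ X hX
  have hXW := hW X hX
  have hZJW := hM.totally_real p W hW Z
  rw [g.symm] at hZJW
  rw [inducedMetric_apply] at hYZ hXZ
  rw [partialDeriv₂_inducedMetric hf ((contDiffAt_coordRep_kahlerForm hH _).differentiableAt
    (by simp)), hδ, christoffel_inducedMetric g.symm g.pos hf (hM.immersed.injective_mfderiv p)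
    ((contDiffAt_coordRep_inner _).of_le (by simp)), ← hXY, covHessian, kahlerForm_apply,
    kahlerForm_apply, hH.inner_J _ (mfderiv 𝓘(ℝ, E') 𝓘(ℝ, E) f p Y), ← hXY, hZJW,
    g.symm _ (mfderiv 𝓘(ℝ, E') 𝓘(ℝ, E) f p Z) (mfderiv 𝓘(ℝ, E') 𝓘(ℝ, E) f p X), hXZ,
    g.symm _ (mfderiv 𝓘(ℝ, E') 𝓘(ℝ, E) f p Z) (mfderiv 𝓘(ℝ, E') 𝓘(ℝ, E) f p Y), hYZ]
  have h0 : δ (mfderiv 𝓘(ℝ, E') 𝓘(ℝ, E) f p X) * g.inner (f p)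
      (mfderiv 𝓘(ℝ, E') 𝓘(ℝ, E) f p Z) (mfderiv 𝓘(ℝ, E') 𝓘(ℝ, E) f p W) = 0 := by
    by_cases hZ0 : mfderiv 𝓘(ℝ, E') 𝓘(ℝ, E) f p Z = 0
    · rw [hZ0, map_zero, zero_apply, mul_zero]
    · have hXJZ := hM.totally_real p Z hZ X
      rw [g.symm] at hXJZ
      rw [conformal_eq_lee hH (hη.extDeriv_kahlerForm (f p)) hδ hZ0 hXZ hXJZ,
        lee_mfderiv_eq_zero hB, zero_mul]
  rw [h0]
  simp only [map_add, add_apply, mul_zero]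
  ring

end CR

/-! ### The leaves of the totally real foliation -/

section Leaves

variable {E : Type*} [NormedAddCommGroup E] [NormedSpace ℝ E] [FiniteDimensional ℝ E]
  {N : Type*} [TopologicalSpace N] [ChartedSpace E N] [IsManifold 𝓘(ℝ, E) ∞ N]
  {E' : Type*} [NormedAddCommGroup E'] [NormedSpace ℝ E'] [FiniteDimensional ℝ E']
  {M : Type u} [TopologicalSpace M] [ChartedSpace E' M] [IsManifold 𝓘(ℝ, E') ∞ M]
  {g : ContMDiffRiemannianMetric 𝓘(ℝ, E) ∞ E (fun x : N => TangentSpace 𝓘(ℝ, E) x)}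
  {J : Π x : N, TangentSpace 𝓘(ℝ, E) x →L[ℝ] TangentSpace 𝓘(ℝ, E) x}
  {η : Π x : N, TangentSpace 𝓘(ℝ, E) x →L[ℝ] ℝ}
  {f : M → N} {D : Π p : M, Submodule ℝ (TangentSpace 𝓘(ℝ, E') p)}
  {k : ℕ} {L : Type u} [TopologicalSpace L] [ChartedSpace (EuclideanSpace ℝ (Fin k)) L]
  [IsManifold 𝓘(ℝ, EuclideanSpace ℝ (Fin k)) ∞ L] {j : L → M}

/-- The second fundamental form of `M` on `D^⊥ × D` is dual, via `J`, to the second fundamental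
form of the leaves of `D^⊥` in `M`. It follows by differentiating `Ω(df Y, df (dj w)) = 0` along
a leaf. -/
theorem inner_covHessian_eq (hN : IsLCK g J) (hη : IsLeeForm g J η) (hM : IsCRSubmanifold g J f D)
    (hB : ∀ p : M, IsNormal (E' := E') g f p (leeVector g η (f p)))
    (hj : IsIntegralManifold (orthogonalDistribution g f D) (k := k) j) (l : L)
    (z w : TangentSpace 𝓘(ℝ, EuclideanSpace ℝ (Fin k)) l)
    {X Y : TangentSpace 𝓘(ℝ, E') (j l)} (hX : X ∈ D (j l)) (hY : Y ∈ D (j l))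
    (hXY : mfderiv 𝓘(ℝ, E') 𝓘(ℝ, E) f (j l) X =
      J (f (j l)) (mfderiv 𝓘(ℝ, E') 𝓘(ℝ, E) f (j l) Y)) :
    g.inner (f (j l)) (covHessian g.inner f (j l)
        (mfderiv 𝓘(ℝ, EuclideanSpace ℝ (Fin k)) 𝓘(ℝ, E') j l z) Y)
      (J (f (j l)) (mfderiv 𝓘(ℝ, E') 𝓘(ℝ, E) f (j l)
        (mfderiv 𝓘(ℝ, EuclideanSpace ℝ (Fin k)) 𝓘(ℝ, E') j l w))) =
    inducedMetric g.inner f (j l) (covHessian (inducedMetric g.inner f) j l z w) X := by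
  have hH := hN.almostHermitian
  have hjs : ContMDiffAt 𝓘(ℝ, EuclideanSpace ℝ (Fin k)) 𝓘(ℝ, E') 2 j l :=
    hj.immersed.smooth.contMDiffAt.of_le two_le_infty
  have hmem : ∀ l v, mfderiv 𝓘(ℝ, EuclideanSpace ℝ (Fin k)) 𝓘(ℝ, E') j l v ∈
      orthogonalDistribution g f D (j l) := fun l v => (hj.tangent l _).2 ⟨v, rfl⟩
  have h1 := partialDeriv₂_add_coordHessian (T := inducedMetric (kahlerForm g J) f) hjs
    ((contDiffAt_coordRep_inducedMetric (n := ∞) (m := 1) two_le_infty two_le_infty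
      hM.immersed.smooth.contMDiffAt ((contDiffAt_coordRep_kahlerForm hH _).of_le
        (by simp))).differentiableAt one_ne_zero)
    (fun x v w => by
      rw [inducedMetric_kahlerForm_antisymm hH,
        (mem_orthogonalDistribution_iff hH hM).1 (hmem x w), neg_zero]) z w Y
  rw [partialDeriv₂_inducedMetric_kahlerForm hN hη hM (hB _) (hmem l z) (hmem l w) hX hY hXY,
    inducedMetric_kahlerForm_antisymm hH, inducedMetric_apply (kahlerForm g J), kahlerForm_apply,
    ← hXY] at h1
  have h2 : inducedMetric g.inner f (j l) (covHessian (inducedMetric g.inner f) j l z w) X =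
      inducedMetric g.inner f (j l) (coordHessian j l z w) X + inducedMetric g.inner f (j l)
        (christoffel (inducedMetric g.inner f) (j l)
          (mfderiv 𝓘(ℝ, EuclideanSpace ℝ (Fin k)) 𝓘(ℝ, E') j l z)
          (mfderiv 𝓘(ℝ, EuclideanSpace ℝ (Fin k)) 𝓘(ℝ, E') j l w)) X := by
    rw [covHessian, map_add, add_apply]
  rw [h2, inducedMetric_apply g.inner f (j l) (coordHessian j l z w)]
  linarith

/-- If `M` is mixed geodesic, the second fundamental form of a leaf of `D^⊥` in `M` is orthogonal to
`D`; it is also orthogonal to the leaf. -/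
theorem IsMixedGeodesic.isTotallyGeodesicFoliation (hmix : IsMixedGeodesic g f D)
    (hN : IsLCK g J) (hη : IsLeeForm g J η) (hM : IsCRSubmanifold g J f D)
    (hB : ∀ p : M, IsNormal (E' := E') g f p (leeVector g η (f p))) :
    IsTotallyGeodesicFoliation (inducedMetric g.inner f) (orthogonalDistribution g f D) := by
  intro k L _ _ _ j hj l z w
  have hf : ∀ p, ContMDiffAt 𝓘(ℝ, E') 𝓘(ℝ, E) 2 f p := fun p =>
    hM.immersed.smooth.contMDiffAt.of_le two_le_infty
  have hjs : ContMDiffAt 𝓘(ℝ, EuclideanSpace ℝ (Fin k)) 𝓘(ℝ, E') 2 j l :=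
    hj.immersed.smooth.contMDiffAt.of_le two_le_infty
  have hmem : ∀ v, mfderiv 𝓘(ℝ, EuclideanSpace ℝ (Fin k)) 𝓘(ℝ, E') j l v ∈
      orthogonalDistribution g f D (j l) := fun v => (hj.tangent l _).2 ⟨v, rfl⟩
  have hpos : ∀ x, ∀ v : TangentSpace 𝓘(ℝ, E') x, v ≠ 0 → 0 < inducedMetric g.inner f x v v :=
    fun x => inducedMetric_pos g.pos (hM.immersed.injective_mfderiv x)
  have hsymm : ∀ x, ∀ v w : TangentSpace 𝓘(ℝ, E') x,
      inducedMetric g.inner f x v w = inducedMetric g.inner f x w v :=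
    fun x v w => g.symm _ _ _
  have hn := normalPart_mfderiv hpos (hj.immersed.injective_mfderiv l)
    (covHessian (inducedMetric g.inner f) j l z w)
  rw [secondFundamentalForm_eq _ hjs]
  -- the second fundamental form of the leaf is orthogonal to the leaf, hence to `D^⊥`,
  -- so it suffices that it belongs to `D^⊥`
  have hD : normalPart (E' := EuclideanSpace ℝ (Fin k)) (inducedMetric g.inner f) j l
      (covHessian (inducedMetric g.inner f) j l z w) ∈ orthogonalDistribution g f D (j l) := by
    intro X hX
    obtain ⟨Y, hY, hXY⟩ := hM.exists_eq_J hX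
    rw [hsymm, normalPart_apply _ _ fun v => by rw [hsymm]; exact hmem v X hX,
      ← inner_covHessian_eq hN hη hM hB hj l z w hX hY hXY,
      ← normalPart_apply (E' := E') g.inner _ fun v => by
        rw [g.symm]; exact hM.totally_real _ _ (hmem w) v,
      ← secondFundamentalForm_eq g.inner (hf _), secondFundamentalForm_symm g.symm (hf _),
      hmix _ _ hY _ (hmem z), map_zero, zero_apply]
  obtain ⟨s, hs⟩ := (hj.tangent l _).1 hD
  by_contra hne
  have h1 := hpos _ _ hne
  have h2 := hn s
  rw [hs] at h2
  exact h1.ne' h2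

/-- If `μ = 0`, the second fundamental form of `M` on `D × D^⊥` is determined by its products with
`J D^⊥`, which are given by the second fundamental form of the leaves of `D^⊥`. -/
theorem IsAntiHolomorphic.isMixedGeodesic (hanti : IsAntiHolomorphic g J f D)
    (hN : IsLCK g J) (hη : IsLeeForm g J η) (hM : IsCRSubmanifold g J f D)
    (hB : ∀ p : M, IsNormal (E' := E') g f p (leeVector g η (f p)))
    (hint : IsIntegrable (orthogonalDistribution g f D))
    (hgeo : IsTotallyGeodesicFoliation (inducedMetric g.inner f) (orthogonalDistribution g f D)) :
    IsMixedGeodesic g f D := by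
  intro p Y hY W hW
  obtain ⟨k, L, _, _, _, j, hj, l, rfl⟩ := hint p
  have hf : ∀ p, ContMDiffAt 𝓘(ℝ, E') 𝓘(ℝ, E) 2 f p := fun p =>
    hM.immersed.smooth.contMDiffAt.of_le two_le_infty
  have hjs : ContMDiffAt 𝓘(ℝ, EuclideanSpace ℝ (Fin k)) 𝓘(ℝ, E') 2 j l :=
    hj.immersed.smooth.contMDiffAt.of_le two_le_infty
  have hmem : ∀ v, mfderiv 𝓘(ℝ, EuclideanSpace ℝ (Fin k)) 𝓘(ℝ, E') j l v ∈
      orthogonalDistribution g f D (j l) := fun v => (hj.tangent l _).2 ⟨v, rfl⟩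
  have hsymm : ∀ x, ∀ v w : TangentSpace 𝓘(ℝ, E') x,
      inducedMetric g.inner f x v w = inducedMetric g.inner f x w v :=
    fun x v w => g.symm _ _ _
  rw [secondFundamentalForm_symm g.symm (hf _), secondFundamentalForm_eq g.inner (hf _)]
  obtain ⟨z, rfl⟩ := (hj.tangent l _).1 hW
  obtain ⟨X, hX, hXY⟩ := hM.exists_J_eq hY
  refine hanti _ _ (normalPart_mfderiv g.pos (hM.immersed.injective_mfderiv _) _) fun W' hW' => ?_
  obtain ⟨w, rfl⟩ := (hj.tangent l _).1 hW'
  rw [normalPart_apply (E' := E') g.inner _ fun v => by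
        rw [g.symm]; exact hM.totally_real _ _ (hmem w) v,
    inner_covHessian_eq hN hη hM hB hj l z w hX hY hXY,
    ← normalPart_apply (E' := EuclideanSpace ℝ (Fin k)) (inducedMetric g.inner f) _ fun v => by
      rw [hsymm]; exact hmem v X hX,
    ← secondFundamentalForm_eq _ hjs, hgeo k L j hj l z w, map_zero, zero_apply]

end Leaves

/-! ### Pulled back 2-forms in charts -/

/-- Dimension of the orthogonal complement for a positive definite form. -/
theorem finrank_orthogonal_of_pos {V : Type*} [AddCommGroup V] [Module ℝ V] [TopologicalSpace V]
    [FiniteDimensional ℝ V] (G : V →L[ℝ] V →L[ℝ] ℝ) (hpos : ∀ v, v ≠ 0 → 0 < G v v)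
    (W W' : Submodule ℝ V) (hW : ∀ w, w ∈ W' ↔ ∀ v ∈ W, G v w = 0) :
    Module.finrank ℝ W' = Module.finrank ℝ V - Module.finrank ℝ W := by
  let B : LinearMap.BilinForm ℝ V := LinearMap.mk₂ ℝ (fun v w => G v w) (by simp) (by simp)
    (by simp) (by simp)
  have hker : B.ker = ⊥ := by
    rw [LinearMap.ker_eq_bot']
    intro v hv
    by_contra hne
    exact (hpos v hne).ne' (congrArg (fun l => l v) hv)
  have h := LinearMap.BilinForm.finrank_add_finrank_orthogonal' (B := B) W
  have hW' : B.orthogonal W = W' := by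
    ext w
    exact (hW w).symm
  rw [hker, inf_bot_eq, finrank_bot, hW'] at h
  omega

section Pullback

variable {E : Type*} [NormedAddCommGroup E] [NormedSpace ℝ E]
  {N : Type*} [TopologicalSpace N] [ChartedSpace E N]
  {E' : Type*} [NormedAddCommGroup E'] [NormedSpace ℝ E']
  {M : Type*} [TopologicalSpace M] [ChartedSpace E' M] [IsManifold 𝓘(ℝ, E') ∞ M]

theorem mfderiv_extChartAt_symm {p : M} {y : E'} (hy : y ∈ (extChartAt 𝓘(ℝ, E') p).target)
    (y₀ b : E') : mfderiv 𝓘(ℝ, E') 𝓘(ℝ, E') (extChartAt 𝓘(ℝ, E') p).symm y (coordFrame y₀ y b) =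
      coordFrame p ((extChartAt 𝓘(ℝ, E') p).symm y) b := by
  have hys : (extChartAt 𝓘(ℝ, E') p).symm y ∈ (chartAt E' p).source := by
    simpa using (extChartAt 𝓘(ℝ, E') p).map_target hy
  have h1 : (coordFrame y₀ y b : TangentSpace 𝓘(ℝ, E') y) = (show E' from b) := by
    rw [coordFrame, TangentBundle.symmL_model_space]
    rfl
  rw [h1, coordFrame, TangentBundle.symmL_trivializationAt hys,
    (extChartAt 𝓘(ℝ, E') p).right_inv hy, modelWithCornersSelf_coe, Set.range_id,
    mfderivWithin_univ]
  rfl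

/-- The components of a pulled back tensor field in a chart of `M` are those of its pullback to the
model space. -/
theorem coordRep_inducedMetric_comp_symm
    (T : Π x : N, TangentSpace 𝓘(ℝ, E) x →L[ℝ] TangentSpace 𝓘(ℝ, E) x →L[ℝ] ℝ)
    {f : M → N} {p : M} {y : E'} (hy : y ∈ (extChartAt 𝓘(ℝ, E') p).target)
    (hf : MDifferentiableAt 𝓘(ℝ, E') 𝓘(ℝ, E) f ((extChartAt 𝓘(ℝ, E') p).symm y)) (y₀ : E') :
    coordRep (inducedMetric T (f ∘ (extChartAt 𝓘(ℝ, E') p).symm)) y₀ y =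
      coordRep (inducedMetric T f) p y := by
  have hd := mdifferentiableAt_extChartAt_symm hy
  have hc : ∀ b : E', mfderiv 𝓘(ℝ, E') 𝓘(ℝ, E) (f ∘ (extChartAt 𝓘(ℝ, E') p).symm) y
      (coordFrame y₀ y b) = mfderiv 𝓘(ℝ, E') 𝓘(ℝ, E) f ((extChartAt 𝓘(ℝ, E') p).symm y)
        (coordFrame p ((extChartAt 𝓘(ℝ, E') p).symm y) b) := by
    intro b
    rw [mfderiv_comp y hf hd, ← mfderiv_extChartAt_symm hy y₀]
    rfl
  ext b c
  change inducedMetric T (f ∘ (extChartAt 𝓘(ℝ, E') p).symm) y (coordFrame y₀ y b)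
    (coordFrame y₀ y c) = _
  rw [coordRep_apply, inducedMetric_apply, inducedMetric_apply, hc, hc]
  rfl

theorem eventually_coordRep_inducedMetric_comp_symm
    (T : Π x : N, TangentSpace 𝓘(ℝ, E) x →L[ℝ] TangentSpace 𝓘(ℝ, E) x →L[ℝ] ℝ)
    {f : M → N} (hf : ContMDiff 𝓘(ℝ, E') 𝓘(ℝ, E) ∞ f) {p : M} {y : E'}
    (hy : y ∈ (extChartAt 𝓘(ℝ, E') p).target) :
    coordRep (inducedMetric T f) p =ᶠ[𝓝 y]
      coordRep (inducedMetric T (f ∘ (extChartAt 𝓘(ℝ, E') p).symm)) y := by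
  filter_upwards [(isOpen_extChartAt_target p).mem_nhds hy] with x hx
  exact (coordRep_inducedMetric_comp_symm T hx (hf.mdifferentiableAt (by simp)) y).symm

theorem contMDiffAt_comp_extChartAt_symm {f : M → N} (hf : ContMDiff 𝓘(ℝ, E') 𝓘(ℝ, E) ∞ f) {p : M}
    {y : E'} (hy : y ∈ (extChartAt 𝓘(ℝ, E') p).target) :
    ContMDiffAt 𝓘(ℝ, E') 𝓘(ℝ, E) ∞ (f ∘ (extChartAt 𝓘(ℝ, E') p).symm) y :=
  hf.contMDiffAt.comp y ((contMDiffOn_extChartAt_symm p).contMDiffAt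
    ((isOpen_extChartAt_target p).mem_nhds hy))

variable [IsManifold 𝓘(ℝ, E) ∞ N]

/-- The exterior derivative commutes with pullback. -/
theorem extDeriv₂_inducedMetric
    {T : Π x : N, TangentSpace 𝓘(ℝ, E) x →L[ℝ] TangentSpace 𝓘(ℝ, E) x →L[ℝ] ℝ}
    (halt : ∀ x v w, T x v w = -T x w v)
    {f : M → N} {p : M} (hf : ContMDiffAt 𝓘(ℝ, E') 𝓘(ℝ, E) 2 f p)
    (hT : DifferentiableAt ℝ (coordRep T (f p)) (extChartAt 𝓘(ℝ, E) (f p) (f p)))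
    (a b c : TangentSpace 𝓘(ℝ, E') p) :
    extDeriv₂ (inducedMetric T f) p a b c =
      extDeriv₂ T (f p) (mfderiv 𝓘(ℝ, E') 𝓘(ℝ, E) f p a) (mfderiv 𝓘(ℝ, E') 𝓘(ℝ, E) f p b)
        (mfderiv 𝓘(ℝ, E') 𝓘(ℝ, E) f p c) := by
  rw [extDeriv₂, extDeriv₂, partialDeriv₂_inducedMetric hf hT, partialDeriv₂_inducedMetric hf hT,
    partialDeriv₂_inducedMetric hf hT, coordHessian_symm hf b a, coordHessian_symm hf c a,
    coordHessian_symm hf c b,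
    halt _ (coordHessian f p a c) (mfderiv 𝓘(ℝ, E') 𝓘(ℝ, E) f p b)]
  ring

theorem contDiffOn_coordRep_inducedMetric
    {T : Π x : N, TangentSpace 𝓘(ℝ, E) x →L[ℝ] TangentSpace 𝓘(ℝ, E) x →L[ℝ] ℝ}
    (hT : ∀ q, ContDiffAt ℝ ∞ (coordRep T q) (extChartAt 𝓘(ℝ, E) q q))
    {f : M → N} (hf : ContMDiff 𝓘(ℝ, E') 𝓘(ℝ, E) ∞ f) (p : M) :
    ContDiffOn ℝ ∞ (coordRep (inducedMetric T f) p) (extChartAt 𝓘(ℝ, E') p).target := by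
  intro y hy
  have h1 := contDiffAt_coordRep_inducedMetric (n := ∞) (m := ∞) (by simp) two_le_infty
    (contMDiffAt_comp_extChartAt_symm hf hy) (hT _)
  exact (ContDiffAt.congr_of_eventuallyEq h1
    (eventually_coordRep_inducedMetric_comp_symm T hf hy)).contDiffWithinAt

/-- A pulled back 2-form is closed if the exterior derivative vanishes on the tangent spaces of the
submanifold. -/
theorem fderiv_coordRep_inducedMetric_closed
    {T : Π x : N, TangentSpace 𝓘(ℝ, E) x →L[ℝ] TangentSpace 𝓘(ℝ, E) x →L[ℝ] ℝ}
    (halt : ∀ x v w, T x v w = -T x w v)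
    (hT : ∀ q, ContDiffAt ℝ ∞ (coordRep T q) (extChartAt 𝓘(ℝ, E) q q))
    {f : M → N} (hf : ContMDiff 𝓘(ℝ, E') 𝓘(ℝ, E) ∞ f)
    (hclosed : ∀ p a b c, extDeriv₂ T (f p) (mfderiv 𝓘(ℝ, E') 𝓘(ℝ, E) f p a)
      (mfderiv 𝓘(ℝ, E') 𝓘(ℝ, E) f p b) (mfderiv 𝓘(ℝ, E') 𝓘(ℝ, E) f p c) = 0)
    (p : M) {y : E'} (hy : y ∈ (extChartAt 𝓘(ℝ, E') p).target) (v w c : E') :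
    fderiv ℝ (coordRep (inducedMetric T f) p) y v w c -
      fderiv ℝ (coordRep (inducedMetric T f) p) y w v c +
      fderiv ℝ (coordRep (inducedMetric T f) p) y c v w = 0 := by
  have hh := contMDiffAt_comp_extChartAt_symm hf hy
  have hd : DifferentiableAt ℝ
      (coordRep (inducedMetric T (f ∘ (extChartAt 𝓘(ℝ, E') p).symm)) y)
      (extChartAt 𝓘(ℝ, E') y y) :=
    (contDiffAt_coordRep_inducedMetric (n := ∞) (m := ∞) (by simp) two_le_infty hh
      (hT _)).differentiableAt (by simp)
  have hfd : fderiv ℝ (coordRep (inducedMetric T f) p) y =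
      fderiv ℝ (coordRep (inducedMetric T (f ∘ (extChartAt 𝓘(ℝ, E') p).symm)) y)
        (extChartAt 𝓘(ℝ, E') y y) :=
    (eventually_coordRep_inducedMetric_comp_symm T hf hy).fderiv_eq
  have hpd : ∀ a b c : E', fderiv ℝ (coordRep (inducedMetric T f) p) y a b c =
      partialDeriv₂ (inducedMetric T (f ∘ (extChartAt 𝓘(ℝ, E') p).symm)) y
        (coordFrame y y a) (coordFrame y y b) (coordFrame y y c) := by
    intro a b c
    rw [partialDeriv₂_eq hd, hfd, coordVector_coordFrame_self, coordVector_coordFrame_self,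
      coordVector_coordFrame_self]
  rw [hpd, hpd, hpd]
  have h := extDeriv₂_inducedMetric halt (hh.of_le two_le_infty)
    ((hT _).differentiableAt (by simp)) (coordFrame y y v) (coordFrame y y w) (coordFrame y y c)
  have hmd := mdifferentiableAt_extChartAt_symm hy
  rw [mfderiv_comp y (hf.mdifferentiableAt (by simp)) hmd] at h
  exact h.trans (hclosed _ _ _ _)

end Pullback

section SingleChart

variable {E' : Type*} [NormedAddCommGroup E'] [NormedSpace ℝ E']
  {M : Type*} [TopologicalSpace M] [ChartedSpace E' M] [IsManifold 𝓘(ℝ, E') ∞ M]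
  {F : Type*} [NormedAddCommGroup F] [NormedSpace ℝ F]
  {L : Type*} [TopologicalSpace L] [ChartedSpace F L] [IsManifold 𝓘(ℝ, F) ∞ L]

/-- The differential of a map given in charts, when the source has a single chart `ι`. -/
theorem mfderiv_extChartAt_symm_comp {ι : L → F} (hι : ∀ l, ⇑(extChartAt 𝓘(ℝ, F) l) = ι)
    {p : M} {σ : F → E'} {l : L} (hσ : ContDiffAt ℝ ∞ σ (ι l))
    (hmem : σ (ι l) ∈ (extChartAt 𝓘(ℝ, E') p).target) :
    ContMDiffAt 𝓘(ℝ, F) 𝓘(ℝ, E') ∞ (fun l => (extChartAt 𝓘(ℝ, E') p).symm (σ (ι l))) l ∧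
    ∀ u : TangentSpace 𝓘(ℝ, F) l,
      mfderiv 𝓘(ℝ, F) 𝓘(ℝ, E') (fun l => (extChartAt 𝓘(ℝ, E') p).symm (σ (ι l))) l u =
        coordFrame p ((extChartAt 𝓘(ℝ, E') p).symm (σ (ι l)))
          (fderiv ℝ σ (ι l) (coordVector l l u)) := by
  have h1 : ContMDiffAt 𝓘(ℝ, F) 𝓘(ℝ, F) ∞ ι l := hι l ▸ contMDiffAt_extChartAt
  have h2 : ContMDiffAt 𝓘(ℝ, F) 𝓘(ℝ, E') ∞ σ (ι l) := hσ.contMDiffAt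
  have h3 : ContMDiffAt 𝓘(ℝ, E') 𝓘(ℝ, E') ∞ (extChartAt 𝓘(ℝ, E') p).symm (σ (ι l)) :=
    (contMDiffOn_extChartAt_symm p).contMDiffAt ((isOpen_extChartAt_target p).mem_nhds hmem)
  have h4 : ContMDiffAt 𝓘(ℝ, F) 𝓘(ℝ, E') ∞ (σ ∘ ι) l := h2.comp l h1
  refine ⟨h3.comp l h4, fun u => ?_⟩
  have e1 := congrArg (fun α => α u) (mfderiv_comp l (h3.mdifferentiableAt (by simp))
    (h4.mdifferentiableAt (by simp)))
  have e2 := congrArg (fun α => α u) (mfderiv_comp l (h2.mdifferentiableAt (by simp))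
    (h1.mdifferentiableAt (by simp)))
  have e3 : mfderiv 𝓘(ℝ, F) 𝓘(ℝ, F) ι l u = coordVector l l u := by
    rw [coordVector, TangentBundle.continuousLinearMapAt_trivializationAt (mem_chart_source F l),
      hι l]
    rfl
  refine e1.trans ?_
  rw [← mfderiv_extChartAt_symm hmem (σ (ι l))]
  refine congrArg _ (e2.trans ?_)
  have e4 : ∀ b : E', (coordFrame (σ (ι l)) (σ (ι l)) b : TangentSpace 𝓘(ℝ, E') (σ (ι l))) =
      (show E' from b) := fun b => by
    rw [coordFrame, TangentBundle.symmL_model_space]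
    rfl
  rw [e4, ← e3, ← mfderiv_eq_fderiv]
  rfl

end SingleChart

/-! ### Integrability of the totally real distribution -/

section Integrability

variable {E : Type*} [NormedAddCommGroup E] [NormedSpace ℝ E]
  {N : Type*} [TopologicalSpace N] [ChartedSpace E N] [IsManifold 𝓘(ℝ, E) ∞ N]
  {E' : Type*} [NormedAddCommGroup E'] [NormedSpace ℝ E']
  {M : Type u} [TopologicalSpace M] [ChartedSpace E' M] [IsManifold 𝓘(ℝ, E') ∞ M]
  {g : ContMDiffRiemannianMetric 𝓘(ℝ, E) ∞ E (fun x : N => TangentSpace 𝓘(ℝ, E) x)}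
  {J : Π x : N, TangentSpace 𝓘(ℝ, E) x →L[ℝ] TangentSpace 𝓘(ℝ, E) x}
  {η : Π x : N, TangentSpace 𝓘(ℝ, E) x →L[ℝ] ℝ}
  {f : M → N} {D : Π p : M, Submodule ℝ (TangentSpace 𝓘(ℝ, E') p)}

/-- In a chart, `D^⊥` is the kernel of the induced 2-form. -/
theorem coordRep_kahlerForm_eq_zero_iff (h : IsAlmostHermitian g J)
    (hM : IsCRSubmanifold g J f D) {p : M} {y : E'}
    (hy : (extChartAt 𝓘(ℝ, E') p).symm y ∈ (chartAt E' p).source) (v : E') :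
    coordRep (inducedMetric (kahlerForm g J) f) p y v = 0 ↔
      coordFrame p ((extChartAt 𝓘(ℝ, E') p).symm y) v ∈
        orthogonalDistribution g f D ((extChartAt 𝓘(ℝ, E') p).symm y) := by
  rw [mem_orthogonalDistribution_iff h hM]
  constructor
  · intro h0 w
    have h1 := congrArg (fun α => α (coordVector p _ w)) h0
    simp only [coordRep_apply, zero_apply] at h1
    rwa [coordFrame_coordVector hy] at h1
  · intro h0
    ext w
    rw [coordRep_apply, h0, zero_apply]

theorem finrank_ker_coordRep_kahlerForm [FiniteDimensional ℝ E'] (h : IsAlmostHermitian g J)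
    (hM : IsCRSubmanifold g J f D) {p : M} {y : E'}
    (hy : (extChartAt 𝓘(ℝ, E') p).symm y ∈ (chartAt E' p).source) :
    Module.finrank ℝ (coordRep (inducedMetric (kahlerForm g J) f) p y).ker =
      Module.finrank ℝ E' - Module.finrank ℝ (D ((extChartAt 𝓘(ℝ, E') p).symm y)) := by
  set x := (extChartAt 𝓘(ℝ, E') p).symm y with hx
  have : FiniteDimensional ℝ (TangentSpace 𝓘(ℝ, E') x) :=
    inferInstanceAs (FiniteDimensional ℝ E')
  let e : E' ≃ₗ[ℝ] TangentSpace 𝓘(ℝ, E') x := LinearEquiv.ofBijective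
    (coordFrame p x).toLinearMap
    ⟨Function.LeftInverse.injective (coordVector_coordFrame hy),
      Function.RightInverse.surjective (coordFrame_coordVector hy)⟩
  have hmap : ((coordRep (inducedMetric (kahlerForm g J) f) p y).ker).map e.toLinearMap =
      orthogonalDistribution g f D x := by
    ext w
    constructor
    · rintro ⟨v, hv, rfl⟩
      exact (coordRep_kahlerForm_eq_zero_iff h hM hy v).1 hv
    · intro hw
      refine ⟨coordVector p x w, (coordRep_kahlerForm_eq_zero_iff h hM hy _).2 ?_,
        coordFrame_coordVector hy w⟩
      rw [← hx, coordFrame_coordVector hy]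
      exact hw
  rw [← LinearEquiv.finrank_map_eq e, hmap,
    finrank_orthogonal_of_pos (inducedMetric g.inner f x)
      (inducedMetric_pos g.pos (hM.immersed.injective_mfderiv x)) (D x) _ (fun w => Iff.rfl),
    ← e.finrank_eq]

/-- `D^⊥` is the kernel of the closed 2-form induced by `Ω`, hence integrable. -/
theorem isIntegrable_orthogonalDistribution [FiniteDimensional ℝ E] [FiniteDimensional ℝ E']
    (hN : IsLCK g J) (hη : IsLeeForm g J η)
    (hM : IsCRSubmanifold g J f D)
    (hB : ∀ p : M, IsNormal (E' := E') g f p (leeVector g η (f p))) :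
    IsIntegrable (orthogonalDistribution g f D) := by
  intro p
  have hH := hN.almostHermitian
  have halt : ∀ x v w, kahlerForm g J x v w = -kahlerForm g J x w v := fun x v w => by
    rw [kahlerForm_apply, kahlerForm_apply, hH.inner_J]
  obtain ⟨U, hU, hpU, m, X, -, hX⟩ := hM.smooth p
  have hfin : ∀ x ∈ U, Module.finrank ℝ (D x) = m := fun x hx => by
    rw [← (hX x hx).2, finrank_span_eq_card (hX x hx).1, Fintype.card_fin]
  have hV : IsOpen ((extChartAt 𝓘(ℝ, E') p).target ∩ (extChartAt 𝓘(ℝ, E') p).symm ⁻¹' U) :=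
    (continuousOn_extChartAt_symm p).isOpen_inter_preimage (isOpen_extChartAt_target p) hU
  have hsrc : ∀ y ∈ (extChartAt 𝓘(ℝ, E') p).target,
      (extChartAt 𝓘(ℝ, E') p).symm y ∈ (chartAt E' p).source := fun y hy => by
    simpa using (extChartAt 𝓘(ℝ, E') p).map_target hy
  have hp : extChartAt 𝓘(ℝ, E') p p ∈
      (extChartAt 𝓘(ℝ, E') p).target ∩ (extChartAt 𝓘(ℝ, E') p).symm ⁻¹' U :=
    ⟨mem_extChartAt_target p, by rwa [Set.mem_preimage, extChartAt_to_inv]⟩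
  obtain ⟨ε, hε, σ, hσ0, hσ, hσinj, hσ'⟩ := exists_integral_ker
    (S := coordRep (inducedMetric (kahlerForm g J) f) p) hV
    ((contDiffOn_coordRep_inducedMetric (contDiffAt_coordRep_kahlerForm hH) hM.immersed.smooth
      p).mono Set.inter_subset_left)
    (k := Module.finrank ℝ E' - m)
    (fun y hy => by rw [finrank_ker_coordRep_kahlerForm hH hM (hsrc y hy.1), hfin _ hy.2])
    (fun y v w => by
      rw [coordRep_apply, coordRep_apply, inducedMetric_kahlerForm_antisymm hH])
    (fun y hy v w _ _ c => fderiv_coordRep_inducedMetric_closed halt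
      (contDiffAt_coordRep_kahlerForm hH) hM.immersed.smooth
      -- the exterior derivative of `Ω` is `η ∧ Ω`, and `η` vanishes on tangent vectors of `M`
      (fun p a b c => by
        rw [hη.extDeriv_kahlerForm, wedge₁₂, lee_mfderiv_eq_zero (hB p),
          lee_mfderiv_eq_zero (hB p), lee_mfderiv_eq_zero (hB p)]
        ring) p hy.1 v w c) hp
  -- the domain of the parametrization, as a manifold with a single chart `ι`
  let ι : ULift.{u} (Metric.ball (0 : EuclideanSpace ℝ (Fin (Module.finrank ℝ E' - m))) ε) →
    EuclideanSpace ℝ (Fin (Module.finrank ℝ E' - m)) := fun l => l.down.1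
  have hι : IsOpenEmbedding ι :=
    Metric.isOpen_ball.isOpenEmbedding_subtypeVal.comp Homeomorph.ulift.isOpenEmbedding
  have hιball : ∀ l, ι l ∈ Metric.ball (0 : EuclideanSpace ℝ (Fin (Module.finrank ℝ E' - m))) ε :=
    fun l => l.down.2
  let l₀ : ULift.{u} (Metric.ball (0 : EuclideanSpace ℝ (Fin (Module.finrank ℝ E' - m))) ε) :=
    ⟨⟨0, Metric.mem_ball_self hε⟩⟩
  have : Nonempty
      (ULift.{u} (Metric.ball (0 : EuclideanSpace ℝ (Fin (Module.finrank ℝ E' - m))) ε)) := ⟨l₀⟩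
  let := hι.singletonChartedSpace
  have hman : IsManifold 𝓘(ℝ, EuclideanSpace ℝ (Fin (Module.finrank ℝ E' - m))) ∞
      (ULift.{u} (Metric.ball (0 : EuclideanSpace ℝ (Fin (Module.finrank ℝ E' - m))) ε)) :=
    hι.isManifold_singleton
  have hchart : ∀ l, ⇑(extChartAt 𝓘(ℝ, EuclideanSpace ℝ (Fin (Module.finrank ℝ E' - m))) l) = ι :=
    fun l => rfl
  have hj := fun l => mfderiv_extChartAt_symm_comp (p := p) hchart
    (hσ.contDiffAt (Metric.isOpen_ball.mem_nhds (hιball l))) (hσ' _ (hιball l)).1.1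
  refine ⟨_, _, _, _, hman, fun l => (extChartAt 𝓘(ℝ, E') p).symm (σ (ι l)),
    ⟨?_, ⟨fun l => (hj l).1, fun l => ?_⟩, ?_, fun l v => ?_⟩, l₀, ?_⟩
  · have : ConnectedSpace (Metric.ball (0 : EuclideanSpace ℝ (Fin (Module.finrank ℝ E' - m))) ε) :=
      isConnected_iff_connectedSpace.1 ((convex_ball _ _).isConnected ⟨0, Metric.mem_ball_self hε⟩)
    exact Homeomorph.ulift.symm.surjective.connectedSpace Homeomorph.ulift.symm.continuous
  · intro u v huv
    rw [(hj l).2, (hj l).2] at huv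
    have h1 := Function.LeftInverse.injective
      (coordVector_coordFrame (hsrc _ (hσ' _ (hιball l)).1.1)) huv
    exact Function.LeftInverse.injective (coordFrame_coordVector_self l)
      ((hσ' _ (hιball l)).2.1 h1)
  · intro l l' hll
    have h1 := (extChartAt 𝓘(ℝ, E') p).symm.injOn (hσ' _ (hιball l)).1.1
      (hσ' _ (hιball l')).1.1 hll
    exact hι.injective (hσinj (hιball l) (hιball l') h1)
  · have hs := hsrc _ (hσ' _ (hιball l)).1.1
    have h1 := (coordRep_kahlerForm_eq_zero_iff hH hM hs (coordVector p _ v)).symm.trans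
      ((hσ' _ (hιball l)).2.2 (coordVector p _ v))
    rw [coordFrame_coordVector hs] at h1
    refine h1.trans ⟨?_, ?_⟩
    · rintro ⟨u, hu⟩
      refine ⟨coordFrame l l u, ?_⟩
      rw [(hj l).2, coordVector_coordFrame_self, hu, coordFrame_coordVector hs]
    · rintro ⟨u, rfl⟩
      refine ⟨coordVector l l u, ?_⟩
      rw [(hj l).2, coordVector_coordFrame hs]
  · change (extChartAt 𝓘(ℝ, E') p).symm (σ 0) = p
    rw [hσ0, extChartAt_to_inv]

end Integrability

end

end CRGeometry

theorem mainTheorem6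
    {E : Type*} [NormedAddCommGroup E] [NormedSpace ℝ E] [FiniteDimensional ℝ E]
    {N : Type*} [TopologicalSpace N] [ChartedSpace E N] [IsManifold 𝓘(ℝ, E) ∞ N]
    {E' : Type*} [NormedAddCommGroup E'] [NormedSpace ℝ E'] [FiniteDimensional ℝ E']
    {M : Type*} [TopologicalSpace M] [ChartedSpace E' M] [IsManifold 𝓘(ℝ, E') ∞ M]
    (g : Bundle.ContMDiffRiemannianMetric 𝓘(ℝ, E) ∞ E (fun x : N => TangentSpace 𝓘(ℝ, E) x))
    (J : Π x : N, TangentSpace 𝓘(ℝ, E) x →L[ℝ] TangentSpace 𝓘(ℝ, E) x)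
    (hN : CRGeometry.IsLCK g J)
    (η : Π x : N, TangentSpace 𝓘(ℝ, E) x →L[ℝ] ℝ)
    (hη : CRGeometry.IsLeeForm g J η)
    (f : M → N) (D : Π p : M, Submodule ℝ (TangentSpace 𝓘(ℝ, E') p))
    (hM : CRGeometry.IsCRSubmanifold g J f D)
    (hB : ∀ p : M, CRGeometry.IsNormal (E' := E') g f p (CRGeometry.leeVector g η (f p))) :
    -- `D^⊥` is integrable, so that the totally real foliation exists
    CRGeometry.IsIntegrable (CRGeometry.orthogonalDistribution g f D) ∧
    -- (i)
    (CRGeometry.IsMixedGeodesic g f D →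
      CRGeometry.IsTotallyGeodesicFoliation (CRGeometry.inducedMetric g.inner f)
        (CRGeometry.orthogonalDistribution g f D)) ∧
    -- (ii)
    (CRGeometry.IsAntiHolomorphic g J f D →
      (CRGeometry.IsMixedGeodesic g f D ↔
        CRGeometry.IsTotallyGeodesicFoliation (CRGeometry.inducedMetric g.inner f)
          (CRGeometry.orthogonalDistribution g f D))) := by
  have hint := CRGeometry.isIntegrable_orthogonalDistribution hN hη hM hB
  exact ⟨hint, fun hmix => hmix.isTotallyGeodesicFoliation hN hη hM hB, fun hanti =>
    ⟨fun hmix => hmix.isTotallyGeodesicFoliation hN hη hM hB,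
      hanti.isMixedGeodesic hN hη hM hB hint⟩⟩
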